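/- **Noise sensitivity.** Let $f_n:\{-1,1\}^{N_n}\to\{-1,1\}$ be a sequence of Boolean functions. Let $\omega$ be uniform on $\{-1,1\}^{N_n}$, and let $\omega^\epsilon$ be obtained from $\omega$ by flipping each bit independently with probability $\epsilon$. The sequence $\{f_n\}$ is *noise sensitive* if $\lim_{n\to\infty}\mathrm{Cov}(f_n(\omega),f_n(\omega^\epsilon))=0$ for every $0<\epsilon\le 1/2$. **Induced function.** A layered graph with an input layer $0$, a single top node, and edges only between consecutive layers induces a Boolean function as follows: the nodes of layer $0$ carry the input bits, every node in a higher layer takes the majority (sign of the sum) of the values of the nodes of the layer below to which it is joined, and the output is the value of the top node. **Graphs.** - $G^{(2)}_n$ has layers $k=0,\dots,n$. Layer $k$ has the nodes $v_{k,1},\dots,v_{k,2^{n-k+1}-1}$, and $v_{k+1,i}$ is joined to $v_{k,j}$ if and only if $|j-2i|\le 1$. - For odd $m\ge 3$ and $T\ge 0$, the cyclic variant $G^{(2')}_{m,T}$ has layers $k=0,\dots,T+1$. For $k\le T$ layer $k$ is a cycle of $m2^{T-k}$ nodes $v_{k,1},\dots,v_{k,m2^{T-k}}$, and for $k<T$ the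 node $v_{k+1,i}$ is joined to $v_{k,j}$ if and only if $j\equiv 2i-1$, $2i$ or $2i+1 \pmod{m2^{T-k}}$. Layer $T+1$ is the single output node, joined to all $m$ nodes of layer $T$. **Theorem.** The sequence of convolutional iterated 3-majority functions with stride 2 induced by $G^{(2)}_n$, $n\ge 0$, is noise sensitive. Moreover, for all sequences of odd integers $m_n\ge 3$ and of integers $T_n\ge 0$ with $T_n\to\infty$, the sequence of functions induced by the cyclic graphs $G^{(2')}_{m_n,T_n}$ is noise sensitive. -/

import Mathlib

open MeasureTheory ProbabilityTheory Filter Topology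

/-- Every subset of `{-1, 1}` is measurable. -/
instance instMeasurableSingletonClassIntUnits : MeasurableSingletonClass ℤˣ where
  measurableSet_singleton u :=
    ⟨{(u : ℤ)}, MeasurableSet.singleton _, by ext v; simp [Units.ext_iff]⟩

/-- The uniform law on `{-1, 1}`. -/
noncomputable def uniformBit : Measure ℤˣ :=
  ENNReal.ofReal (1 / 2) • Measure.dirac 1 + ENNReal.ofReal (1 / 2) • Measure.dirac (-1)

/-- The law of a single noise bit: `-1` (flip) with probability `ε`, `1` (keep) with
probability `1 - ε`. -/
noncomputable def noiseBit (ε : ℝ) : Measure ℤˣ :=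
  ENNReal.ofReal (1 - ε) • Measure.dirac 1 + ENNReal.ofReal ε • Measure.dirac (-1)

/-- The joint law of a uniform input `ω` and an independent i.i.d. vector `s` of noise bits.
The perturbed input is the coordinatewise product `ω * s`. -/
noncomputable def noiseLaw (ι : Type) [Fintype ι] (ε : ℝ) :
    Measure ((ι → ℤˣ) × (ι → ℤˣ)) :=
  (Measure.pi fun _ : ι => uniformBit).prod (Measure.pi fun _ : ι => noiseBit ε)

/-- `Cov(f(ω), f(ω^ε))`. -/
noncomputable def noiseCov {ι : Type} [Fintype ι] (f : (ι → ℤˣ) → ℤˣ) (ε : ℝ) : ℝ :=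
  covariance (fun p : (ι → ℤˣ) × (ι → ℤˣ) => (((f p.1 : ℤˣ) : ℤ) : ℝ))
    (fun p : (ι → ℤˣ) × (ι → ℤˣ) => (((f (p.1 * p.2) : ℤˣ) : ℤ) : ℝ)) (noiseLaw ι ε)

/-- Noise sensitivity of a sequence of Boolean functions `f n : {-1, 1}^(ι n) → {-1, 1}`. -/
def NoiseSensitive {ι : ℕ → Type} [∀ n, Fintype (ι n)]
    (f : ∀ n, (ι n → ℤˣ) → ℤˣ) : Prop :=
  ∀ ε : ℝ, 0 < ε → ε ≤ 1 / 2 → Tendsto (fun n => noiseCov (f n) ε) atTop (𝓝 0)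

/-- A finite layered graph. Layer `k` (for `k = 0, …, height`) has the nodes
`v_{k,1}, …, v_{k, width k}`, layer `0` is the input layer and the top layer is a single node.
`edge k i j` says that `v_{k+1,i}` is joined to `v_{k,j}`.  Edges join consecutive layers only.
Values of `width` and `edge` above the height play no role. -/
structure LayeredGraph where
  height : ℕ
  width : ℕ → ℕ
  width_height : width height = 1
  edge : ℕ → ℕ → ℕ → Prop

namespace LayeredGraph

/-- The nodes of layer `k`. -/
abbrev Node (G : LayeredGraph) (k : ℕ) : Type := ↥(Finset.Icc 1 (G.width k))

open Classical in
/-- The children in layer `k` of a node in layer `k + 1`. -/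
noncomputable def children (G : LayeredGraph) (k : ℕ) (v : G.Node (k + 1)) :
    Finset (G.Node k) :=
  Finset.univ.filter fun u => G.edge k v u

/-- The value of every node: input bits on layer `0`, and the sign of the sum of the values of the
children (their majority, when their number is odd) on the higher layers. -/
noncomputable def value (G : LayeredGraph) (ω : G.Node 0 → ℤˣ) : (k : ℕ) → G.Node k → ℤˣ
  | 0, v => ω v
  | k + 1, v => if 0 < ∑ u ∈ G.children k v, ((G.value ω k u : ℤˣ) : ℤ) then 1 else -1

/-- The single node of the top layer. -/
def root (G : LayeredGraph) : G.Node G.height :=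
  ⟨1, by simp [G.width_height]⟩

/-- The Boolean function induced by the graph. -/
noncomputable def output (G : LayeredGraph) (ω : G.Node 0 → ℤˣ) : ℤˣ :=
  G.value ω G.height G.root

end LayeredGraph

/-- The graph of the convolutional iterated 3-majority function with stride 2 and `n` levels of
majorities: layer `k` has `2 ^ (n - k + 1) - 1` nodes, and `v_{k+1,i}` is joined to `v_{k,j}` iff
`|j - 2 i| ≤ 1`. -/
def strideTwoGraph (n : ℕ) : LayeredGraph where
  height := n
  width k := 2 ^ (n - k + 1) - 1
  width_height := by simp
  edge _ i j := |(j : ℤ) - 2 * i| ≤ 1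

/-- The cyclic variant. For `k ≤ T` layer `k` is a cycle of `m * 2 ^ (T - k)` nodes; for `k < T` the
node `v_{k+1,i}` is joined to `v_{k,j}` iff `j` is congruent to one of `2i-1, 2i, 2i+1` modulo the
length of the cycle in layer `k`.  The output node, in layer `T + 1`, is joined to all the `m` nodes
of layer `T`. -/
def strideTwoCycle (m T : ℕ) : LayeredGraph where
  height := T + 1
  width k := if k ≤ T then m * 2 ^ (T - k) else 1
  width_height := by simp
  edge k i j :=
    if k < T then ∃ e : ℤ, |e| ≤ 1 ∧ (j : ℤ) ≡ 2 * i + e [ZMOD ((m * 2 ^ (T - k) : ℕ) : ℤ)]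
    else True

/-! The proof uses the Schramm–Steif method: a function computed by a randomized query algorithm
that reads each input bit with probability at most `δ` has Walsh weight at most `d * δ` on level
`d`. As Cov(f(ω), f(ω^ε)) is the sum over nonempty `S` of the squared Walsh coefficients times `(1 -
2ε) ^ |S|`, it is at most `δ` times a constant depending on `ε` (`abs_noiseCov_le`). It remains to
find algorithms whose revealment tends to `0`.

Both graphs are modelled on the integers, where node `j` has children `2j-1, 2j, 2j+1`. One coin in
ℤ/4 is drawn per layer. The three children of a node have distinct residues mod 4, so at most one
matches the coin; that child is withheld and evaluated only if its two siblings disagree. The coin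
depends on the layer alone, so an odd node, which has two parents, is withheld by both or by
neither. `reveals_stable` shows that the inputs read form a stopping set that determines the value.

Only two nodes of each layer have `x` in their cone. Suppose that, in layer `k`, the nearby nodes
whose cones are disjoint from the cones of these two all equal `1`. Then two correctly drawn coins
block every path from layer `k+3` down to `x` (`not_revealsAbove_add_three`). This event has
probability at least `2⁻³⁴`, the node values being positively correlated, and is independent of what
happens below the two nodes. Hence every three layers the probability of revealing `x` drops by a
fixed factor (`revealProb_add_three_le`), and the covariance decays exponentially in the height
(`abs_noiseCov_le_of_strideMaj`). -/

open scoped BigOperators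

/-! ### Walsh expansion on the discrete cube. -/

section Walsh

variable {ι : Type}

/-- The Walsh function `∏ i ∈ S, ω i`. -/
def walsh (S : Finset ι) (ω : ι → ℤˣ) : ℝ := ∏ i ∈ S, (((ω i : ℤˣ) : ℤ) : ℝ)

lemma cast_units_mul_self (u : ℤˣ) : ((u : ℤ) : ℝ) * ((u : ℤ) : ℝ) = 1 := by
  rcases Int.units_eq_one_or u with rfl | rfl <;> norm_num

lemma walsh_mul_self (S : Finset ι) (ω : ι → ℤˣ) : walsh S ω * walsh S ω = 1 := by
  rw [walsh, ← Finset.prod_mul_distrib]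
  exact Finset.prod_eq_one fun i _ => cast_units_mul_self _

lemma walsh_mul (S : Finset ι) (ω η : ι → ℤˣ) : walsh S (ω * η) = walsh S ω * walsh S η := by
  simp [walsh, Finset.prod_mul_distrib]

variable [DecidableEq ι]

/-- Flip one coordinate. -/
def flipBit (i : ι) (ω : ι → ℤˣ) : ι → ℤˣ := Function.update ω i (-ω i)

lemma flipBit_flipBit (i : ι) (ω : ι → ℤˣ) : flipBit i (flipBit i ω) = ω := by
  simp [flipBit]

lemma flipBit_apply_of_ne {i j : ι} (h : j ≠ i) (ω : ι → ℤˣ) : flipBit i ω j = ω j := by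
  simp [flipBit, h]

lemma walsh_flipBit_of_mem {S : Finset ι} {i : ι} (h : i ∈ S) (ω : ι → ℤˣ) :
    walsh S (flipBit i ω) = -walsh S ω := by
  unfold walsh
  rw [← Finset.mul_prod_erase S _ h, ← Finset.mul_prod_erase S _ h]
  have : ∏ j ∈ S.erase i, (((flipBit i ω j : ℤˣ) : ℤ) : ℝ) =
      ∏ j ∈ S.erase i, (((ω j : ℤˣ) : ℤ) : ℝ) :=
    Finset.prod_congr rfl fun j hj => by rw [flipBit_apply_of_ne (Finset.ne_of_mem_erase hj)]
  rw [this]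
  simp [flipBit]

lemma walsh_flipBit_of_notMem {S : Finset ι} {i : ι} (h : i ∉ S) (ω : ι → ℤˣ) :
    walsh S (flipBit i ω) = walsh S ω :=
  Finset.prod_congr rfl fun j hj => by
    rw [flipBit_apply_of_ne (ne_of_mem_of_not_mem hj h)]

variable [Fintype ι]

lemma expect_eq_zero_of_flipBit (i : ι) (g : (ι → ℤˣ) → ℝ) (h : ∀ ω, g (flipBit i ω) = -g ω) :
    𝔼 ω, g ω = 0 := by
  have h1 : 𝔼 ω, g ω = 𝔼 ω, g (flipBit i ω) :=
    Fintype.expect_equiv (Function.Involutive.toPerm (flipBit i) (flipBit_flipBit i)) _ _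
      fun ω => congrArg g (flipBit_flipBit i ω).symm
  simp only [h, Finset.expect_neg_distrib] at h1
  linarith

/-- The Walsh coefficient of `f` at `S`. -/
noncomputable def walshCoeff (f : (ι → ℤˣ) → ℝ) (S : Finset ι) : ℝ := 𝔼 ω, f ω * walsh S ω

/-- The sum factors as `∏ (1 + ω i * η i)`, and a coordinate where `ω` and `η` differ gives a zero
factor. -/
lemma sum_walsh_mul_walsh (ω η : ι → ℤˣ) :
    ∑ S : Finset ι, walsh S ω * walsh S η = if η = ω then (Fintype.card (ι → ℤˣ) : ℝ) else 0 := by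
  have h : ∑ S : Finset ι, walsh S ω * walsh S η =
      ∏ i, (1 + (((ω i : ℤˣ) : ℤ) : ℝ) * (((η i : ℤˣ) : ℤ) : ℝ)) := by
    rw [Finset.prod_one_add, Finset.powerset_univ]
    simp [walsh, Finset.prod_mul_distrib]
  rw [h]
  split_ifs with e
  · subst e
    simp only [cast_units_mul_self]
    simp; norm_num
  · obtain ⟨i, hi⟩ := Function.ne_iff.1 e
    refine Finset.prod_eq_zero (Finset.mem_univ i) ?_
    rcases Int.units_eq_one_or (ω i) with h1 | h1 <;> rcases Int.units_eq_one_or (η i) with h2 | h2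
      <;> simp_all

lemma sum_walshCoeff_mul_walsh (f : (ι → ℤˣ) → ℝ) (ω : ι → ℤˣ) :
    ∑ S : Finset ι, walshCoeff f S * walsh S ω = f ω := by
  simp only [walshCoeff, Fintype.expect_eq_sum_div_card, div_mul_eq_mul_div, Finset.sum_mul]
  rw [← Finset.sum_div, Finset.sum_comm]
  have : ∀ η : ι → ℤˣ, ∑ S : Finset ι, f η * walsh S η * walsh S ω =
      f η * if η = ω then (Fintype.card (ι → ℤˣ) : ℝ) else 0 := fun η => by
    rw [← sum_walsh_mul_walsh, Finset.mul_sum]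
    exact Finset.sum_congr rfl fun S _ => by ring
  simp only [this]
  simp

end Walsh

/-! ### Stopping sets and the Schramm–Steif inequality. -/

section Revealment

variable {ι : Type}

open Classical in
/-- The indicator that the random set `J` meets `S`. -/
noncomputable def meets (J : (ι → ℤˣ) → Set ι) (S : Finset ι) (ω : ι → ℤˣ) : ℝ :=
  if ∃ i ∈ S, i ∈ J ω then 1 else 0

lemma meets_mul_self (J : (ι → ℤˣ) → Set ι) (S : Finset ι) (ω : ι → ℤˣ) :
    meets J S ω * meets J S ω = meets J S ω := by
  unfold meets; split_ifs <;> simp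

lemma meets_congr {J : (ι → ℤˣ) → Set ι} {ω η : ι → ℤˣ} (h : J ω = J η) (S : Finset ι) :
    meets J S ω = meets J S η := by
  unfold meets; rw [h]

variable [DecidableEq ι]

/-- If `i` is in `J` both before and after the flip, `S` is met both times; otherwise `J` does not
change at all. -/
lemma meets_flipBit {J : (ι → ℤˣ) → Set ι}
    (hJ : ∀ ω i, i ∉ J ω → J (flipBit i ω) = J ω) {S : Finset ι} {i : ι} (hi : i ∈ S)
    (ω : ι → ℤˣ) : meets J S (flipBit i ω) = meets J S ω := by
  by_cases h : i ∈ J ω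
  · by_cases h' : i ∈ J (flipBit i ω)
    · simp [meets, show ∃ i ∈ S, i ∈ J ω from ⟨i, hi, h⟩,
        show ∃ j ∈ S, j ∈ J (flipBit i ω) from ⟨i, hi, h'⟩]
    · have := hJ _ _ h'
      rw [flipBit_flipBit] at this
      exact absurd (this ▸ h) h'
  · exact meets_congr (hJ _ _ h) S

variable [Fintype ι]

/-- Equal cardinality gives `i ∈ S \ T` and `j ∈ T \ S`. The integrand splits into three terms, each
odd under flipping `i` or `j`. In the middle one the factor `meets J S - 1` vanishes when `i` is in
`J`, and otherwise the flip leaves `J` alone. -/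
lemma expect_walsh_meets_eq_zero {J : (ι → ℤˣ) → Set ι}
    (hJ : ∀ ω i, i ∉ J ω → J (flipBit i ω) = J ω) {S T : Finset ι} (hST : S ≠ T)
    (hc : S.card = T.card) :
    𝔼 ω, (walsh S ω * meets J S ω) * (walsh T ω * meets J T ω) = 0 := by
  obtain ⟨i, hiS, hiT⟩ : ∃ i ∈ S, i ∉ T := by
    by_contra! h
    exact hST (Finset.eq_of_subset_of_card_le h hc.ge)
  obtain ⟨j, hjT, hjS⟩ : ∃ i ∈ T, i ∉ S := by
    by_contra! h
    exact hST (Finset.eq_of_subset_of_card_le h hc.le).symm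
  have h1 : 𝔼 ω, (walsh S ω * meets J S ω) * (walsh T ω * 1) = 0 :=
    expect_eq_zero_of_flipBit i _ fun ω => by
      rw [walsh_flipBit_of_mem hiS, walsh_flipBit_of_notMem hiT, meets_flipBit hJ hiS]; ring
  have h2 : 𝔼 ω, (walsh S ω * (meets J S ω - 1)) * (walsh T ω * (meets J T ω - 1)) = 0 := by
    refine expect_eq_zero_of_flipBit i _ fun ω => ?_
    rw [walsh_flipBit_of_mem hiS, walsh_flipBit_of_notMem hiT, meets_flipBit hJ hiS]
    by_cases h : i ∈ J ω
    · have : meets J S ω = 1 := by simp [meets, show ∃ i ∈ S, i ∈ J ω from ⟨i, hiS, h⟩]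
      simp [this]
    · have : meets J T (flipBit i ω) = meets J T ω := meets_congr (hJ _ _ h) T
      rw [this]; ring
  have h3 : 𝔼 ω, (walsh S ω * 1) * (walsh T ω * (meets J T ω - 1)) = 0 :=
    expect_eq_zero_of_flipBit j _ fun ω => by
      rw [walsh_flipBit_of_mem hjT, walsh_flipBit_of_notMem hjS, meets_flipBit hJ hjT]; ring
  have h4 : ∀ ω, (walsh S ω * meets J S ω) * (walsh T ω * meets J T ω) =
      (walsh S ω * meets J S ω) * (walsh T ω * 1) +
      ((walsh S ω * (meets J S ω - 1)) * (walsh T ω * (meets J T ω - 1)) +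
        (walsh S ω * 1) * (walsh T ω * (meets J T ω - 1))) := fun ω => by ring
  simp only [h4]
  rw [Finset.expect_add_distrib, Finset.expect_add_distrib, h1, h2, h3]
  simp

/-- The Walsh weight of `f` at level `d`. -/
noncomputable def walshWeight (f : (ι → ℤˣ) → ℝ) (d : ℕ) : ℝ :=
  ∑ S ∈ Finset.univ.powersetCard d, walshCoeff f S ^ 2

lemma walshWeight_nonneg (f : (ι → ℤˣ) → ℝ) (d : ℕ) : 0 ≤ walshWeight f d :=
  Finset.sum_nonneg fun _ _ => sq_nonneg _

/-- Cauchy–Schwarz for `f` against the level-`d` part `H` of its expansion, each character being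
kept only when `J` meets `S`. Pairing with `f` loses nothing, and the terms of `H` stay orthogonal.
-/
lemma walshWeight_sq_le {f : (ι → ℤˣ) → ℝ} (hf : ∀ ω, f ω ^ 2 ≤ 1) {J : (ι → ℤˣ) → Set ι}
    (hJ : ∀ ω i, i ∉ J ω → J (flipBit i ω) = J ω)
    (hfJ : ∀ ω i, i ∉ J ω → f (flipBit i ω) = f ω) {d : ℕ} (hd : d ≠ 0) :
    walshWeight f d ^ 2 ≤
      ∑ S ∈ Finset.univ.powersetCard d, walshCoeff f S ^ 2 * 𝔼 ω, meets J S ω := by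
  set P := (Finset.univ : Finset ι).powersetCard d with hP
  set H : (ι → ℤˣ) → ℝ := fun ω => ∑ S ∈ P, walshCoeff f S * (walsh S ω * meets J S ω) with hH
  have h1 : walshWeight f d = 𝔼 ω, f ω * H ω := by
    have : ∀ ω, f ω * H ω = ∑ S ∈ P, walshCoeff f S * (f ω * walsh S ω * meets J S ω) := fun ω => by
      rw [hH, Finset.mul_sum]; exact Finset.sum_congr rfl fun S _ => by ring
    simp only [this]
    rw [Finset.expect_sum_comm]
    refine Finset.sum_congr rfl fun S hS => ?_
    rw [← Finset.mul_expect, sq]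
    congr 1
    obtain ⟨i, hi⟩ : S.Nonempty := by
      rw [← Finset.card_pos, (Finset.mem_powersetCard.1 hS).2]; omega
    -- Where `J` misses `S`, flipping `i ∈ S` preserves `f` and `J` but reverses the character.
    have h0 : 𝔼 ω, f ω * walsh S ω * (meets J S ω - 1) = 0 := by
      refine expect_eq_zero_of_flipBit i _ fun ω => ?_
      rw [walsh_flipBit_of_mem hi, meets_flipBit hJ hi]
      by_cases h : i ∈ J ω
      · have : meets J S ω = 1 := by simp [meets, show ∃ i ∈ S, i ∈ J ω from ⟨i, hi, h⟩]
        simp [this]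
      · rw [hfJ _ _ h]; ring
    have h2 : ∀ ω, f ω * walsh S ω * meets J S ω =
      f ω * walsh S ω + f ω * walsh S ω * (meets J S ω - 1) := fun ω => by ring
    simp only [h2]
    rw [Finset.expect_add_distrib, h0, add_zero, walshCoeff]
  have h2 : 𝔼 ω, H ω ^ 2 = ∑ S ∈ P, walshCoeff f S ^ 2 * 𝔼 ω, meets J S ω := by
    have : ∀ ω, H ω ^ 2 = ∑ S ∈ P, ∑ T ∈ P, walshCoeff f S * walshCoeff f T *
        ((walsh S ω * meets J S ω) * (walsh T ω * meets J T ω)) := fun ω => by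
      rw [sq, hH, Finset.sum_mul_sum]
      exact Finset.sum_congr rfl fun S _ => Finset.sum_congr rfl fun T _ => by ring
    simp only [this]
    rw [Finset.expect_sum_comm]
    refine Finset.sum_congr rfl fun S hS => ?_
    rw [Finset.expect_sum_comm, Finset.sum_eq_single S]
    · rw [← Finset.mul_expect, sq]
      congr 1
      refine Finset.expect_congr rfl fun ω _ => ?_
      rw [mul_mul_mul_comm, walsh_mul_self, meets_mul_self, one_mul]
    · intro T hT hne
      rw [← Finset.mul_expect, expect_walsh_meets_eq_zero hJ hne.symm, mul_zero]
      rw [(Finset.mem_powersetCard.1 hS).2, (Finset.mem_powersetCard.1 hT).2]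
    · exact fun h => absurd hS h
  rw [← h2, h1]
  refine (Finset.expect_mul_sq_le_sq_mul_sq _ _ _).trans ?_
  have h3 : 𝔼 ω, f ω ^ 2 ≤ 1 := Finset.expect_le Finset.univ_nonempty fun ω _ => hf ω
  exact mul_le_of_le_one_left (Finset.expect_nonneg fun _ _ => sq_nonneg _) h3

open Classical in
/-- The Schramm–Steif inequality: a randomized stopping set that determines `f` and has revealment
at most `δ` bounds the Walsh weight at level `d` by `d * δ`. -/
lemma walshWeight_le {κ : Type} [Fintype κ] [Nonempty κ] {f : (ι → ℤˣ) → ℝ}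
    (hf : ∀ ω, f ω ^ 2 ≤ 1) {J : κ → (ι → ℤˣ) → Set ι}
    (hJ : ∀ c ω i, i ∉ J c ω → J c (flipBit i ω) = J c ω)
    (hfJ : ∀ c ω i, i ∉ J c ω → f (flipBit i ω) = f ω) {δ : ℝ} (hδ : 0 ≤ δ)
    (hrev : ∀ i, 𝔼 c, 𝔼 ω, (if i ∈ J c ω then (1 : ℝ) else 0) ≤ δ) {d : ℕ} (hd : d ≠ 0) :
    walshWeight f d ≤ d * δ := by
  have h1 : walshWeight f d ^ 2 ≤ 𝔼 c, ∑ S ∈ Finset.univ.powersetCard d,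
      walshCoeff f S ^ 2 * 𝔼 ω, meets (J c) S ω := by
    rw [← Fintype.expect_const (ι := κ) (walshWeight f d ^ 2)]
    exact Finset.expect_le_expect fun c _ => walshWeight_sq_le hf (hJ c) (hfJ c) hd
  rw [Finset.expect_sum_comm] at h1
  have h2 : ∀ S ∈ (Finset.univ : Finset ι).powersetCard d,
      𝔼 c, walshCoeff f S ^ 2 * 𝔼 ω, meets (J c) S ω ≤ walshCoeff f S ^ 2 * (d * δ) := by
    intro S hS
    rw [← Finset.mul_expect]
    refine mul_le_mul_of_nonneg_left ?_ (sq_nonneg _)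
    have h3 : ∀ c ω, meets (J c) S ω ≤ ∑ i ∈ S, if i ∈ J c ω then (1 : ℝ) else 0 := by
      intro c ω
      unfold meets
      split_ifs with h
      · obtain ⟨i, hi, hij⟩ := h
        have := Finset.single_le_sum (f := fun i => if i ∈ J c ω then (1 : ℝ) else 0)
          (fun i _ => by split_ifs <;> norm_num) hi
        simpa [hij] using this
      · exact Finset.sum_nonneg fun i _ => by split_ifs <;> norm_num
    calc 𝔼 c, 𝔼 ω, meets (J c) S ω
        ≤ 𝔼 c, 𝔼 ω, ∑ i ∈ S, (if i ∈ J c ω then (1 : ℝ) else 0) :=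
          Finset.expect_le_expect fun c _ => Finset.expect_le_expect fun ω _ => h3 c ω
      _ = ∑ i ∈ S, 𝔼 c, 𝔼 ω, (if i ∈ J c ω then (1 : ℝ) else 0) := by
          simp only [Finset.expect_sum_comm]
      _ ≤ ∑ i ∈ S, δ := Finset.sum_le_sum fun i _ => hrev i
      _ = d * δ := by rw [Finset.sum_const, (Finset.mem_powersetCard.1 hS).2, nsmul_eq_mul]
  -- The weight itself reappears on the right, so one factor cancels.
  have h3 : walshWeight f d ^ 2 ≤ walshWeight f d * (d * δ) := by
    refine h1.trans ((Finset.sum_le_sum h2).trans_eq ?_)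
    rw [← Finset.sum_mul, walshWeight]
  rcases (walshWeight_nonneg f d).eq_or_lt with h0 | h0
  · rw [← h0]; positivity
  · rw [sq] at h3
    exact le_of_mul_le_mul_left h3 h0

end Revealment

/-! ### Noise covariance in terms of Walsh weights. -/

section Covariance

lemma isProbabilityMeasure_noiseBit {ε : ℝ} (h0 : 0 ≤ ε) (h1 : ε ≤ 1) :
    IsProbabilityMeasure (noiseBit ε) :=
  ⟨by
    simp only [noiseBit, Measure.add_apply, Measure.smul_apply, measure_univ, smul_eq_mul, mul_one]
    rw [← ENNReal.ofReal_add (by linarith) h0]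
    simp⟩

lemma uniformBit_eq_noiseBit : uniformBit = noiseBit (1 / 2) := by
  norm_num [uniformBit, noiseBit]

lemma integral_noiseBit {ε : ℝ} (h0 : 0 ≤ ε) (h1 : ε ≤ 1) (g : ℤˣ → ℝ) :
    ∫ u, g u ∂noiseBit ε = (1 - ε) * g 1 + ε * g (-1) := by
  have hi : ∀ μ : Measure ℤˣ, IsFiniteMeasure μ → Integrable g μ := fun μ _ => Integrable.of_finite
  rw [noiseBit, integral_add_measure, integral_smul_measure, integral_smul_measure,
    integral_dirac, integral_dirac, ENNReal.toReal_ofReal h0, ENNReal.toReal_ofReal (by linarith)]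
  · simp
  · exact (hi _ inferInstance).smul_measure ENNReal.ofReal_ne_top
  · exact (hi _ inferInstance).smul_measure ENNReal.ofReal_ne_top

variable {ι : Type} [Fintype ι] [DecidableEq ι]

lemma walsh_eq_prod (S : Finset ι) (ω : ι → ℤˣ) :
    walsh S ω = ∏ i, if i ∈ S then (((ω i : ℤˣ) : ℤ) : ℝ) else 1 := by
  simp [walsh, Finset.prod_ite_mem]

lemma integral_walsh_noiseBit {ε : ℝ} (h0 : 0 ≤ ε) (h1 : ε ≤ 1) (S : Finset ι) :
    ∫ ω, walsh S ω ∂(Measure.pi fun _ : ι => noiseBit ε) = (1 - 2 * ε) ^ S.card := by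
  have := isProbabilityMeasure_noiseBit h0 h1
  simp only [walsh_eq_prod]
  rw [integral_fintype_prod_eq_prod
    (f := fun i (u : ℤˣ) => if i ∈ S then ((u : ℤ) : ℝ) else 1)]
  simp only [integral_noiseBit h0 h1]
  rw [← Finset.prod_const, ← Finset.prod_subset (Finset.subset_univ S)]
  · exact Finset.prod_congr rfl fun i hi => by simp [hi]; ring
  · intro i _ hi
    simp [hi]

lemma integral_walsh_mul_walsh_uniformBit (S T : Finset ι) :
    ∫ ω, walsh S ω * walsh T ω ∂(Measure.pi fun _ : ι => uniformBit) = if S = T then 1 else 0 := by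
  have := isProbabilityMeasure_noiseBit (ε := 1 / 2) (by norm_num) (by norm_num)
  rw [uniformBit_eq_noiseBit]
  simp only [walsh_eq_prod, ← Finset.prod_mul_distrib]
  rw [integral_fintype_prod_eq_prod (f := fun i (u : ℤˣ) =>
    (if i ∈ S then ((u : ℤ) : ℝ) else 1) * (if i ∈ T then ((u : ℤ) : ℝ) else 1))]
  simp only [integral_noiseBit (show (0 : ℝ) ≤ 1 / 2 by norm_num) (by norm_num)]
  split_ifs with h
  · subst h
    exact Finset.prod_eq_one fun i _ => by split_ifs <;> norm_num
  · obtain ⟨i, hi⟩ : ∃ i, ¬(i ∈ S ↔ i ∈ T) := by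
      by_contra! hh
      exact h (Finset.ext hh)
    refine Finset.prod_eq_zero (Finset.mem_univ i) ?_
    by_cases h1 : i ∈ S <;> by_cases h2 : i ∈ T <;>
      first | exact absurd (by tauto) hi | norm_num [h1, h2]

lemma covariance_walsh {ε : ℝ} (h0 : 0 ≤ ε) (h1 : ε ≤ 1) (S T : Finset ι) :
    cov[fun p : (ι → ℤˣ) × (ι → ℤˣ) => walsh S p.1, fun p => walsh T (p.1 * p.2); noiseLaw ι ε] =
      if S = T ∧ S ≠ ∅ then (1 - 2 * ε) ^ S.card else 0 := by
  have := isProbabilityMeasure_noiseBit h0 h1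
  have := isProbabilityMeasure_noiseBit (ε := 1 / 2) (by norm_num) (by norm_num)
  rw [← uniformBit_eq_noiseBit] at this
  unfold noiseLaw
  rw [covariance_eq_sub (MemLp.of_discrete) (MemLp.of_discrete)]
  have e1 := integral_prod_mul (μ := Measure.pi fun _ : ι => uniformBit)
    (ν := Measure.pi fun _ : ι => noiseBit ε) (fun ω => walsh S ω * walsh T ω) (walsh T)
  have e2 := integral_prod_mul (μ := Measure.pi fun _ : ι => uniformBit)
    (ν := Measure.pi fun _ : ι => noiseBit ε) (walsh T) (walsh T)
  have e3 := integral_prod_mul (μ := Measure.pi fun _ : ι => uniformBit)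
    (ν := Measure.pi fun _ : ι => noiseBit ε) (walsh S) (fun _ => 1)
  have e4 : ∀ U : Finset ι, ∫ ω, walsh U ω ∂(Measure.pi fun _ : ι => uniformBit) =
      if U = ∅ then 1 else 0 := fun U => by
    rw [← integral_walsh_mul_walsh_uniformBit U ∅]; simp [walsh]
  simp only [Pi.mul_apply, walsh_mul, ← mul_assoc]
  rw [e1, e2]
  simp only [mul_one] at e3
  rw [e3, integral_walsh_mul_walsh_uniformBit, integral_walsh_noiseBit h0 h1, e4, e4]
  by_cases hST : S = T
  · subst hST
    by_cases hS : S = ∅ <;> simp [hS]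
  · by_cases hS : S = ∅ <;> by_cases hT : T = ∅ <;> simp_all

lemma noiseCov_eq {ε : ℝ} (h0 : 0 ≤ ε) (h1 : ε ≤ 1) (f : (ι → ℤˣ) → ℤˣ) :
    noiseCov f ε = ∑ S : Finset ι, if S ≠ ∅ then
      walshCoeff (fun ω => (((f ω : ℤˣ) : ℤ) : ℝ)) S ^ 2 * (1 - 2 * ε) ^ S.card else 0 := by
  have := isProbabilityMeasure_noiseBit h0 h1
  have := isProbabilityMeasure_noiseBit (ε := 1 / 2) (by norm_num) (by norm_num)
  rw [← uniformBit_eq_noiseBit] at this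
  have : IsProbabilityMeasure (noiseLaw ι ε) := by unfold noiseLaw; infer_instance
  set a := walshCoeff (fun ω => (((f ω : ℤˣ) : ℤ) : ℝ)) with ha
  have hX : (fun p : (ι → ℤˣ) × (ι → ℤˣ) => (((f p.1 : ℤˣ) : ℤ) : ℝ)) =
      ∑ S : Finset ι, a S • fun p : (ι → ℤˣ) × (ι → ℤˣ) => walsh S p.1 := by
    ext p
    rw [← sum_walshCoeff_mul_walsh (fun ω => (((f ω : ℤˣ) : ℤ) : ℝ)) p.1]
    simp [ha]
  have hY : (fun p : (ι → ℤˣ) × (ι → ℤˣ) => (((f (p.1 * p.2) : ℤˣ) : ℤ) : ℝ)) =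
      ∑ S : Finset ι, a S • fun p : (ι → ℤˣ) × (ι → ℤˣ) => walsh S (p.1 * p.2) := by
    ext p
    rw [← sum_walshCoeff_mul_walsh (fun ω => (((f ω : ℤˣ) : ℤ) : ℝ)) (p.1 * p.2)]
    simp [ha]
  rw [noiseCov, hX, hY, covariance_sum_sum (fun _ => MemLp.of_discrete) fun _ => MemLp.of_discrete]
  refine Finset.sum_congr rfl fun S _ => ?_
  simp only [covariance_smul_left, covariance_smul_right, covariance_walsh h0 h1]
  rw [Finset.sum_eq_single S]
  · split_ifs <;> simp_all; ring
  · intro T _ hT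
    simp [hT.symm]
  · simp

open Classical in
/-- A Boolean function determined by a randomized stopping set of revealment at most `δ` has noise
covariance of order `δ`. -/
theorem abs_noiseCov_le {κ : Type} [Fintype κ] [Nonempty κ] (f : (ι → ℤˣ) → ℤˣ)
    {J : κ → (ι → ℤˣ) → Set ι} (hJ : ∀ c ω i, i ∉ J c ω → J c (flipBit i ω) = J c ω)
    (hfJ : ∀ c ω i, i ∉ J c ω → f (flipBit i ω) = f ω) {δ : ℝ} (hδ : 0 ≤ δ)
    (hrev : ∀ i, 𝔼 c, 𝔼 ω, (if i ∈ J c ω then (1 : ℝ) else 0) ≤ δ)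
    {ε : ℝ} (h0 : 0 < ε) (h1 : ε ≤ 1 / 2) :
    |noiseCov f ε| ≤ δ * ((1 - 2 * ε) / (1 - (1 - 2 * ε)) ^ 2) := by
  set g : (ι → ℤˣ) → ℝ := fun ω => (((f ω : ℤˣ) : ℤ) : ℝ) with hg
  set ρ := 1 - 2 * ε with hρ
  have hρ0 : 0 ≤ ρ := by linarith
  have hρ1 : ρ < 1 := by linarith
  have e := noiseCov_eq h0.le (by linarith) f
  rw [abs_of_nonneg (by rw [e]; exact Finset.sum_nonneg fun S _ => by split_ifs <;> positivity), e]
  have hw : ∀ d, d ≠ 0 → walshWeight g d ≤ d * δ := fun d hd =>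
    walshWeight_le (fun ω => by simp only [hg, sq, cast_units_mul_self, le_refl]) hJ
      (fun c ω i hi => by simp only [hg, hfJ c ω i hi]) hδ hrev hd
  have h2 : (∑ S : Finset ι, if S ≠ ∅ then walshCoeff g S ^ 2 * ρ ^ S.card else 0) =
      ∑ d ∈ Finset.range (Fintype.card ι + 1), if d ≠ 0 then walshWeight g d * ρ ^ d else 0 := by
    rw [← Finset.powerset_univ, Finset.sum_powerset, Finset.card_univ]
    refine Finset.sum_congr rfl fun d _ => ?_
    split_ifs with hd
    · rw [walshWeight, Finset.sum_mul]
      refine Finset.sum_congr rfl fun S hS => ?_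
      have hc := (Finset.mem_powersetCard.1 hS).2
      have : S ≠ ∅ := by rintro rfl; exact hd (by simpa using hc.symm)
      rw [if_pos this, hc]
    · refine Finset.sum_eq_zero fun S hS => ?_
      have hc := (Finset.mem_powersetCard.1 hS).2
      have : S = ∅ := by rw [← Finset.card_eq_zero, hc]; omega
      simp [this]
  rw [h2]
  have hs : Summable fun d : ℕ => (d : ℝ) * ρ ^ d := by
    simpa using summable_pow_mul_geometric_of_norm_lt_one (R := ℝ) 1
      (by rwa [Real.norm_of_nonneg hρ0])
  calc _ ≤ ∑ d ∈ Finset.range (Fintype.card ι + 1), δ * ((d : ℝ) * ρ ^ d) := by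
        refine Finset.sum_le_sum fun d _ => ?_
        split_ifs with hd
        · have := mul_le_mul_of_nonneg_right (hw d hd) (pow_nonneg hρ0 d)
          linarith
        · positivity
    _ = δ * ∑ d ∈ Finset.range (Fintype.card ι + 1), (d : ℝ) * ρ ^ d := by rw [Finset.mul_sum]
    _ ≤ δ * ∑' d : ℕ, (d : ℝ) * ρ ^ d :=
        mul_le_mul_of_nonneg_left (hs.sum_le_tsum _ fun d _ => by positivity) hδ
    _ = _ := by rw [tsum_coe_mul_geometric_of_norm_lt_one (by rwa [Real.norm_of_nonneg hρ0])]

end Covariance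

/-! ### Iterated majority on the integers and the query algorithm. -/

section IntegerModel

/-- The sign of the sum of three bits. -/
def majThree (a b c : ℤˣ) : ℤˣ := if 0 < (a : ℤ) + b + c then 1 else -1

/-- Iterated 3-majority with stride 2 on the integers. -/
def strideMaj (w : ℤ → ℤˣ) : ℕ → ℤ → ℤˣ
  | 0, j => w j
  | k + 1, j => majThree (strideMaj w k (2 * j - 1)) (strideMaj w k (2 * j))
      (strideMaj w k (2 * j + 1))

/-- Evaluating node `j` of layer `k` reveals the input `x`. The child of residue `c k` modulo `4`, if
there is one, is evaluated only when its two siblings differ. -/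
def Reveals (c : ℕ → ℤ) (w : ℤ → ℤˣ) : ℕ → ℤ → ℤ → Prop
  | 0, j, x => x = j
  | k + 1, j, x =>
    ((((2 * j - 1) % 4 ≠ c k) ∨ strideMaj w k (2 * j) ≠ strideMaj w k (2 * j + 1)) ∧
      Reveals c w k (2 * j - 1) x) ∨
    ((((2 * j) % 4 ≠ c k) ∨ strideMaj w k (2 * j - 1) ≠ strideMaj w k (2 * j + 1)) ∧
      Reveals c w k (2 * j) x) ∨
    ((((2 * j + 1) % 4 ≠ c k) ∨ strideMaj w k (2 * j - 1) ≠ strideMaj w k (2 * j)) ∧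
      Reveals c w k (2 * j + 1) x)

lemma majThree_self_left (a b : ℤˣ) : majThree a a b = a := by revert a b; decide

lemma majThree_self_right (a b : ℤˣ) : majThree b a a = a := by revert a b; decide

lemma majThree_self_outer (a b : ℤˣ) : majThree a b a = a := by revert a b; decide

lemma majThree_neg (a b c : ℤˣ) : majThree (-a) (-b) (-c) = -majThree a b c := by
  revert a b c; decide

lemma majThree_mono {a b c a' b' c' : ℤˣ} (ha : a ≤ a') (hb : b ≤ b') (hc : c ≤ c') :
    majThree a b c ≤ majThree a' b' c' := by
  revert a b c a' b' c'; decide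

lemma strideMaj_mono {w w' : ℤ → ℤˣ} (h : w ≤ w') (k : ℕ) (j : ℤ) :
    strideMaj w k j ≤ strideMaj w' k j := by
  induction k generalizing j with
  | zero => exact h j
  | succ k ih => exact majThree_mono (ih _) (ih _) (ih _)

lemma strideMaj_neg (w : ℤ → ℤˣ) (k : ℕ) (j : ℤ) :
    strideMaj (-w) k j = -strideMaj w k j := by
  induction k generalizing j with
  | zero => rfl
  | succ k ih => simp only [strideMaj, ih, majThree_neg]

lemma abs_sub_lt_of_child {k : ℕ} {j u y : ℤ} (hu : |u - 2 * j| ≤ 1)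
    (hy : |y - 2 ^ k * u| < 2 ^ k) : |y - 2 ^ (k + 1) * j| < 2 ^ (k + 1) := by
  have hp : (0 : ℤ) < 2 ^ k := by positivity
  rw [abs_le] at hu
  rw [abs_lt] at hy ⊢
  rw [pow_succ]
  constructor <;> nlinarith

lemma abs_child_left (j : ℤ) : |2 * j - 1 - 2 * j| ≤ 1 := by
  rw [abs_le]; constructor <;> linarith

lemma abs_child_mid (j : ℤ) : |2 * j - 2 * j| ≤ 1 := by simp

lemma abs_child_right (j : ℤ) : |2 * j + 1 - 2 * j| ≤ 1 := by
  rw [abs_le]; constructor <;> linarith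

lemma strideMaj_congr {w w' : ℤ → ℤˣ} {k : ℕ} {j : ℤ}
    (h : ∀ y, |y - 2 ^ k * j| < 2 ^ k → w y = w' y) : strideMaj w k j = strideMaj w' k j := by
  induction k generalizing j with
  | zero => exact h j (by simp)
  | succ k ih =>
    have h' : ∀ u, |u - 2 * j| ≤ 1 → strideMaj w k u = strideMaj w' k u := fun u hu =>
      ih fun y hy => h y (abs_sub_lt_of_child hu hy)
    simp only [strideMaj, h' _ (abs_child_left j), h' _ (abs_child_mid j), h' _ (abs_child_right j)]

lemma Reveals.exists_child {c : ℕ → ℤ} {w : ℤ → ℤˣ} {k : ℕ} {j x : ℤ}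
    (h : Reveals c w (k + 1) j x) : ∃ u, |u - 2 * j| ≤ 1 ∧ Reveals c w k u x := by
  rcases h with h | h | h
  · exact ⟨_, abs_child_left j, h.2⟩
  · exact ⟨_, abs_child_mid j, h.2⟩
  · exact ⟨_, abs_child_right j, h.2⟩

lemma Reveals.abs_sub_lt {c : ℕ → ℤ} {w : ℤ → ℤˣ} {k : ℕ} {j x : ℤ} (h : Reveals c w k j x) :
    |x - 2 ^ k * j| < 2 ^ k := by
  induction k generalizing j with
  | zero => have : x = j := h
            simp [this]
  | succ k ih =>
    obtain ⟨u, hu, h⟩ := h.exists_child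
    exact abs_sub_lt_of_child hu (ih h)

lemma reveals_congr {c c' : ℕ → ℤ} {w w' : ℤ → ℤˣ} {k : ℕ} {j : ℤ} (hc : ∀ i < k, c i = c' i)
    (h : ∀ y, |y - 2 ^ k * j| < 2 ^ k → w y = w' y) (x : ℤ) :
    Reveals c w k j x ↔ Reveals c' w' k j x := by
  induction k generalizing j with
  | zero => rfl
  | succ k ih =>
    have h1 : ∀ u, |u - 2 * j| ≤ 1 → strideMaj w k u = strideMaj w' k u := fun u hu =>
      strideMaj_congr fun y hy => h y (abs_sub_lt_of_child hu hy)
    have h2 : ∀ u, |u - 2 * j| ≤ 1 → (Reveals c w k u x ↔ Reveals c' w' k u x) := fun u hu =>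
      ih (fun i hi => hc i (by omega)) fun y hy => h y (abs_sub_lt_of_child hu hy)
    simp only [Reveals, h1 _ (abs_child_left j), h1 _ (abs_child_mid j), h1 _ (abs_child_right j),
      h2 _ (abs_child_left j), h2 _ (abs_child_mid j), h2 _ (abs_child_right j),
      hc k (Nat.lt_succ_self k)]

/-- The stopping-set property. Children that are evaluated keep their values and revealed sets by
induction; a skipped child has agreeing siblings, which already decide the majority. -/
lemma reveals_stable {c : ℕ → ℤ} {w w' : ℤ → ℤˣ} {k : ℕ} {j : ℤ}
    (h : ∀ y, w y ≠ w' y → ¬Reveals c w k j y) :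
    strideMaj w' k j = strideMaj w k j ∧ ∀ x, Reveals c w' k j x ↔ Reveals c w k j x := by
  induction k generalizing j with
  | zero =>
    refine ⟨?_, fun x => Iff.rfl⟩
    by_contra hne
    exact h j (fun e => hne e.symm) rfl
  | succ k ih =>
    have hl : ((2 * j - 1) % 4 ≠ c k ∨ strideMaj w k (2 * j) ≠ strideMaj w k (2 * j + 1)) → _ :=
      fun hh => ih (j := 2 * j - 1) fun y hy hr => h y hy (Or.inl ⟨hh, hr⟩)
    have hm : ((2 * j) % 4 ≠ c k ∨ strideMaj w k (2 * j - 1) ≠ strideMaj w k (2 * j + 1)) → _ :=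
      fun hh => ih (j := 2 * j) fun y hy hr => h y hy (Or.inr (Or.inl ⟨hh, hr⟩))
    have hr : ((2 * j + 1) % 4 ≠ c k ∨ strideMaj w k (2 * j - 1) ≠ strideMaj w k (2 * j)) → _ :=
      fun hh => ih (j := 2 * j + 1) fun y hy hr => h y hy (Or.inr (Or.inr ⟨hh, hr⟩))
    have all : (∀ u, |u - 2 * j| ≤ 1 → strideMaj w' k u = strideMaj w k u ∧
        ∀ x, Reveals c w' k u x ↔ Reveals c w k u x) →
        strideMaj w' (k + 1) j = strideMaj w (k + 1) j ∧
          ∀ x, Reveals c w' (k + 1) j x ↔ Reveals c w (k + 1) j x := by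
      intro H
      have L := H _ (abs_child_left j)
      have M := H _ (abs_child_mid j)
      have R := H _ (abs_child_right j)
      simp only [strideMaj, Reveals, L.1, M.1, R.1, L.2, M.2, R.2, implies_true, and_self]
    have cases3 : ∀ u, |u - 2 * j| ≤ 1 → u = 2 * j - 1 ∨ u = 2 * j ∨ u = 2 * j + 1 := by
      intro u hu
      rw [abs_le] at hu
      omega
    -- At most one child has the coin's residue, so the other two are evaluated unconditionally.
    by_cases h1 : (2 * j - 1) % 4 = c k
    · have M := hm (Or.inl (by omega))
      have R := hr (Or.inl (by omega))
      by_cases e : strideMaj w k (2 * j) = strideMaj w k (2 * j + 1)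
      · have e' : strideMaj w' k (2 * j) = strideMaj w' k (2 * j + 1) := by rw [M.1, R.1, e]
        refine ⟨?_, fun x => ?_⟩
        · simp only [strideMaj]
          rw [← e, ← e', majThree_self_right, majThree_self_right, M.1]
        · have h2 : (2 * j) % 4 ≠ c k := by omega
          have h3 : (2 * j + 1) % 4 ≠ c k := by omega
          simp only [Reveals, e, e', M.2, R.2]
          simp [h1, h2, h3]
      · have L := hl (Or.inr e)
        refine all fun u hu => ?_
        rcases cases3 u hu with rfl | rfl | rfl <;> assumption
    · have L := hl (Or.inl h1)
      by_cases h2 : (2 * j) % 4 = c k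
      · have R := hr (Or.inl (by omega))
        by_cases e : strideMaj w k (2 * j - 1) = strideMaj w k (2 * j + 1)
        · have e' : strideMaj w' k (2 * j - 1) = strideMaj w' k (2 * j + 1) := by rw [L.1, R.1, e]
          refine ⟨?_, fun x => ?_⟩
          · simp only [strideMaj]
            rw [← e, ← e', majThree_self_outer, majThree_self_outer, L.1]
          · have h3 : (2 * j + 1) % 4 ≠ c k := by omega
            simp only [Reveals, e, e', L.2, R.2]
            simp [h1, h2, h3]
        · have M := hm (Or.inr e)
          refine all fun u hu => ?_
          rcases cases3 u hu with rfl | rfl | rfl <;> assumption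
      · have M := hm (Or.inl h2)
        by_cases hh : ((2 * j + 1) % 4 ≠ c k ∨ strideMaj w k (2 * j - 1) ≠ strideMaj w k (2 * j))
        · have R := hr hh
          refine all fun u hu => ?_
          rcases cases3 u hu with rfl | rfl | rfl <;> assumption
        · push Not at hh
          obtain ⟨h3, e⟩ := hh
          have e' : strideMaj w' k (2 * j - 1) = strideMaj w' k (2 * j) := by rw [L.1, M.1, e]
          refine ⟨?_, fun x => ?_⟩
          · simp only [strideMaj]
            rw [← e, ← e', majThree_self_left, majThree_self_left, L.1]
          · simp only [Reveals, e, e', L.2, M.2]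
            simp [h1, h2, h3]

lemma strideMaj_add_period {w : ℤ → ℤˣ} {k : ℕ} {p : ℤ} (hw : ∀ y, w (y + 2 ^ k * p) = w y)
    (j : ℤ) : strideMaj w k (j + p) = strideMaj w k j := by
  induction k generalizing j p with
  | zero => simpa [strideMaj] using hw j
  | succ k ih =>
    have h : ∀ u, strideMaj w k (u + 2 * p) = strideMaj w k u := fun u =>
      ih (fun y => by rw [← hw y]; ring_nf) u
    simp only [strideMaj]
    rw [← h (2 * j - 1), ← h (2 * j), ← h (2 * j + 1)]
    ring_nf

/-- An even period in layer `k` becomes a multiple of 4 in the layer below, so the shift respects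
the residues that the coins test. -/
lemma reveals_add_period {c : ℕ → ℤ} {w : ℤ → ℤˣ} {k : ℕ} {p : ℤ} (hp : 2 ∣ p)
    (hw : ∀ y, w (y + 2 ^ k * p) = w y) (j x : ℤ) :
    Reveals c w k (j + p) (x + 2 ^ k * p) ↔ Reveals c w k j x := by
  induction k generalizing j p with
  | zero => simp [Reveals]
  | succ k ih =>
    have hw' : ∀ y, w (y + 2 ^ k * (2 * p)) = w y := fun y => by rw [← hw y]; ring_nf
    have h1 : ∀ u, strideMaj w k (u + 2 * p) = strideMaj w k u := strideMaj_add_period hw'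
    have h2 : ∀ u, Reveals c w k (u + 2 * p) (x + 2 ^ (k + 1) * p) ↔ Reveals c w k u x := fun u => by
      rw [← ih (Dvd.intro p rfl) hw' u, show (2 : ℤ) ^ (k + 1) * p = 2 ^ k * (2 * p) by ring]
    have e1 : 2 * (j + p) - 1 = 2 * j - 1 + 2 * p := by ring
    have e2 : 2 * (j + p) = 2 * j + 2 * p := by ring
    have e3 : 2 * (j + p) + 1 = 2 * j + 1 + 2 * p := by ring
    have m : ∀ u, (u + 2 * p) % 4 = u % 4 := fun u => by omega
    simp only [Reveals]
    rw [e1, e3, e2]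
    simp only [h1, h2, m]

/-- Evaluating both nodes of layer `k` whose cones contain `x` reveals `x`. -/
def RevealsAbove (c : ℕ → ℤ) (w : ℤ → ℤˣ) (x : ℤ) (k : ℕ) : Prop :=
  Reveals c w k (x / 2 ^ k) x ∨ Reveals c w k (x / 2 ^ k + 1) x

/-- The cone of `j` is the open interval of radius `2 ^ k` about `2 ^ k * j`, so at most two cones
contain `x`. -/
lemma Reveals.eq_or_eq {c : ℕ → ℤ} {w : ℤ → ℤˣ} {k : ℕ} {j x : ℤ} (h : Reveals c w k j x) :
    j = x / 2 ^ k ∨ j = x / 2 ^ k + 1 := by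
  have h1 := h.abs_sub_lt
  have hp : (0 : ℤ) < 2 ^ k := by positivity
  have h2 := Int.mul_ediv_add_emod x (2 ^ k)
  have h3 := Int.emod_nonneg x hp.ne'
  have h4 := Int.emod_lt_of_pos x hp
  rw [abs_lt] at h1
  set a := x / 2 ^ k
  have h5 : a ≤ j := by
    by_contra! hlt
    nlinarith
  have h6 : j ≤ a + 1 := by
    by_contra! hlt
    nlinarith
  omega

lemma Reveals.revealsAbove {c : ℕ → ℤ} {w : ℤ → ℤˣ} {k : ℕ} {j x : ℤ} (h : Reveals c w k j x) :
    RevealsAbove c w x k := by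
  rcases h.eq_or_eq with rfl | rfl
  exacts [Or.inl h, Or.inr h]

lemma RevealsAbove.of_succ {c : ℕ → ℤ} {w : ℤ → ℤˣ} {x : ℤ} {k : ℕ}
    (h : RevealsAbove c w x (k + 1)) : RevealsAbove c w x k := by
  rcases h with h | h
  all_goals
    obtain ⟨u, -, h⟩ := h.exists_child
    exact h.revealsAbove

lemma RevealsAbove.mono {c : ℕ → ℤ} {w : ℤ → ℤˣ} {x : ℤ} {k l : ℕ} (hkl : k ≤ l)
    (h : RevealsAbove c w x l) : RevealsAbove c w x k := by
  induction hkl with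
  | refl => exact h
  | step _ ih => exact ih h.of_succ

lemma ediv_two_pow_succ (x : ℤ) (k : ℕ) : x / 2 ^ (k + 1) = x / 2 ^ k / 2 := by
  rw [pow_succ, Int.ediv_ediv_of_nonneg (by positivity)]

/-- If `v` is a child, the coin withholds it and its siblings agree, so no path to `x` passes
through it. -/
lemma Reveals.exists_ne {c : ℕ → ℤ} {w : ℤ → ℤˣ} {k : ℕ} {j x v : ℤ}
    (h : Reveals c w (k + 1) j x) (hv : c k = v % 4)
    (h1 : ∀ u, |u - 2 * j| ≤ 1 → u ≠ v → strideMaj w k u = 1) :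
    ∃ u, |u - 2 * j| ≤ 1 ∧ u ≠ v ∧ Reveals c w k u x := by
  rcases h with ⟨hn, h⟩ | ⟨hn, h⟩ | ⟨hn, h⟩
  · refine ⟨_, abs_child_left j, ?_, h⟩
    rintro rfl
    rw [h1 _ (abs_child_mid j) (by omega), h1 _ (abs_child_right j) (by omega)] at hn
    simp [hv] at hn
  · refine ⟨_, abs_child_mid j, ?_, h⟩
    rintro rfl
    rw [h1 _ (abs_child_left j) (by omega), h1 _ (abs_child_right j) (by omega)] at hn
    simp [hv] at hn
  · refine ⟨_, abs_child_right j, ?_, h⟩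
    rintro rfl
    rw [h1 _ (abs_child_left j) (by omega), h1 _ (abs_child_mid j) (by omega)] at hn
    simp [hv] at hn

/-- If the nodes of layer `k` near `x` whose values do not involve the cones around `x` are all `1`,
then a suitable choice of two layer coins prevents `x` from being revealed. -/
lemma not_revealsAbove_add_three {c : ℕ → ℤ} {w : ℤ → ℤˣ} {x : ℤ} {k : ℕ}
    (hA : ∀ j, x / 2 ^ k - 14 ≤ j → j ≤ x / 2 ^ k + 15 → (j < x / 2 ^ k - 1 ∨ x / 2 ^ k + 2 < j) →
      strideMaj w k j = 1)
    (hc1 : c (k + 1) = (2 * (x / 2 ^ (k + 2)) + 1) % 4)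
    (hc2 : c (k + 2) = (x / 2 ^ (k + 1) - x / 2 ^ (k + 2)) % 4) :
    ¬RevealsAbove c w x (k + 3) := by
  intro hR
  have e1 := ediv_two_pow_succ x k
  have e2 : x / 2 ^ (k + 2) = x / 2 ^ (k + 1) / 2 := ediv_two_pow_succ x (k + 1)
  have e3 : x / 2 ^ (k + 3) = x / 2 ^ (k + 2) / 2 := ediv_two_pow_succ x (k + 2)
  set a0 := x / 2 ^ k with ha0
  set a1 := x / 2 ^ (k + 1) with ha1
  set a2 := x / 2 ^ (k + 2) with ha2
  set a3 := x / 2 ^ (k + 3) with ha3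
  -- Such a node has two children known to be `1`. The descendants of `a3` and `a3 + 1` in layer `k`
  -- lie in `[8 * a3 - 7, 8 * a3 + 15]` and `8 * a3 ≤ a0 ≤ 8 * a3 + 7`, whence the bounds 14 and 15.
  have hB : ∀ j, 4 * a3 - 3 ≤ j → j ≤ 4 * a3 + 7 → j ≠ a1 → j ≠ a1 + 1 →
      strideMaj w (k + 1) j = 1 := by
    intro j h1 h2 h3 h4
    rw [strideMaj]
    rcases lt_or_gt_of_ne h3 with h | h
    · rw [hA (2 * j - 1) (by omega) (by omega) (by omega), hA (2 * j) (by omega) (by omega) (by omega),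
        majThree_self_left]
    · rw [hA (2 * j) (by omega) (by omega) (by omega),
        hA (2 * j + 1) (by omega) (by omega) (by omega), majThree_self_right]
  -- Only `a1 - a2`, which is `a2` or `a2 + 1` by the parity of `a1`, has both `a1` and `a1 + 1` as
  -- children; every other node has two children equal to `1`.
  have hC : ∀ j, 2 * a3 - 1 ≤ j → j ≤ 2 * a3 + 3 → j ≠ a1 - a2 → strideMaj w (k + 2) j = 1 := by
    intro j h1 h2 h3
    rw [strideMaj]
    by_cases hl : 2 * j - 1 = a1 ∨ 2 * j - 1 = a1 + 1
    · rw [hB (2 * j) (by omega) (by omega) (by omega) (by omega),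
        hB (2 * j + 1) (by omega) (by omega) (by omega) (by omega), majThree_self_right]
    · by_cases hm : 2 * j = a1 ∨ 2 * j = a1 + 1
      · rw [hB (2 * j - 1) (by omega) (by omega) (by omega) (by omega),
          hB (2 * j + 1) (by omega) (by omega) (by omega) (by omega), majThree_self_outer]
      · rw [hB (2 * j - 1) (by omega) (by omega) (by omega) (by omega),
          hB (2 * j) (by omega) (by omega) (by omega) (by omega), majThree_self_left]
  obtain ⟨j, hj, hR⟩ : ∃ j, (j = a3 ∨ j = a3 + 1) ∧ Reveals c w (k + 3) j x := by
    rcases hR with h | h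
    exacts [⟨_, Or.inl rfl, h⟩, ⟨_, Or.inr rfl, h⟩]
  obtain ⟨u, hu, hne, hR⟩ := Reveals.exists_ne (k := k + 2) hR hc2 fun u hu hne => by
    rw [abs_le] at hu
    exact hC u (by omega) (by omega) hne
  have hu2 : u = a2 ∨ u = a2 + 1 := hR.eq_or_eq
  obtain ⟨v, hv, hne', hR⟩ := Reveals.exists_ne (k := k + 1) hR hc1 fun v hv hne' => by
    rw [abs_le] at hv
    exact hB v (by omega) (by omega) (by omega) (by omega)
  -- The path avoids `a1 - a2`, so it uses the other of `a2, a2 + 1`. The only child of that node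
  -- among `a1, a1 + 1` is the odd one, `2 * a2 + 1`, which the other coin blocks.
  have hv1 : v = a1 ∨ v = a1 + 1 := hR.eq_or_eq
  rw [abs_le] at hv
  omega

end IntegerModel

/-! ### Independence on finite product spaces. -/

section Product

/-- Exchanging the coordinates outside `C` between two independent copies is a bijection that turns
`f p.1 * g p.2` into `f p.1 * g p.1`. -/
lemma expect_mul_of_disjoint {I V : Type} [Fintype I] [DecidableEq I] [Fintype V] (C : Set I)
    {f g : (I → V) → ℝ} (hf : ∀ ω η, (∀ i ∈ C, ω i = η i) → f ω = f η)
    (hg : ∀ ω η, (∀ i, i ∉ C → ω i = η i) → g ω = g η) :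
    𝔼 ω, f ω * g ω = (𝔼 ω, f ω) * 𝔼 ω, g ω := by
  classical
  rcases isEmpty_or_nonempty (I → V) with h | h
  · simp
  let mix : (I → V) → (I → V) → I → V := fun ω η i => if i ∈ C then ω i else η i
  have hmix : ∀ ω η, mix (mix ω η) (mix η ω) = ω := fun ω η => by
    funext i; by_cases hi : i ∈ C <;> simp [mix, hi]
  let e : (I → V) × (I → V) ≃ (I → V) × (I → V) :=
    Function.Involutive.toPerm (fun p => (mix p.1 p.2, mix p.2 p.1)) fun p => by simp [hmix]
  have h1 : 𝔼 p : (I → V) × (I → V), f p.1 * g p.2 =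
      𝔼 p : (I → V) × (I → V), f p.1 * g p.1 := by
    refine Fintype.expect_equiv e _ _ fun p => ?_
    rw [hf p.1 (mix p.1 p.2) fun i hi => by simp [mix, hi],
      hg p.2 (mix p.1 p.2) fun i hi => by simp [mix, hi]]
    rfl
  rw [Fintype.expect_mul_expect, ← Finset.expect_product', Finset.univ_product_univ, h1,
    ← Finset.univ_product_univ, Finset.expect_product]
  simp

lemma expect_ite_apply_eq {I V : Type} [Fintype I] [DecidableEq I] [Fintype V] [DecidableEq V]
    [Nonempty V] (i : I) (v : V) :
    𝔼 ω : I → V, (if ω i = v then (1 : ℝ) else 0) = 1 / Fintype.card V := by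
  have h : ∀ u, 𝔼 ω : I → V, (if ω i = u then (1 : ℝ) else 0) =
      𝔼 ω : I → V, (if ω i = v then (1 : ℝ) else 0) := fun u =>
    Fintype.expect_equiv (Equiv.arrowCongr (Equiv.refl I) (Equiv.swap u v)) _ _ fun ω => by
      simp [Equiv.swap_apply_eq_iff]
  have h2 : ∑ u, 𝔼 ω : I → V, (if ω i = u then (1 : ℝ) else 0) = 1 := by
    rw [← Finset.expect_sum_comm]
    simp
  simp only [h, Finset.sum_const, Finset.card_univ, nsmul_eq_mul] at h2
  rw [eq_div_iff (by positivity), mul_comm, h2]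

end Product

/-! ### Random inputs pulled back to the integers. -/

section Lift

variable {ι : Type} (π : ℤ → Option ι)

/-- Pull an input back to the integers; sites outside the range of the input carry `1`. -/
def pullInput (ω : ι → ℤˣ) (y : ℤ) : ℤˣ := (π y).elim 1 ω

lemma pullInput_mono : Monotone (pullInput π) := fun ω η h y => by
  unfold pullInput
  cases π y with
  | none => exact le_rfl
  | some i => exact h i

lemma pullInput_congr {ω η : ι → ℤˣ} {y : ℤ} (h : ∀ i, π y = some i → ω i = η i) :
    pullInput π ω y = pullInput π η y := by
  unfold pullInput
  cases e : π y with
  | none => rfl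
  | some i => exact h i e

lemma neg_pullInput_le (ω : ι → ℤˣ) : -pullInput π ω ≤ pullInput π (-ω) := fun y => by
  have h : (-1 : ℤˣ) ≤ 1 := by decide
  simp only [Pi.neg_apply, pullInput]
  cases π y with
  | none => exact h
  | some i => exact le_rfl

variable [Fintype ι] [DecidableEq ι]

/-- Iterated majority is odd and monotone, and the sites outside the input carry `1`; so at least
one of `ω` and `-ω` gives the value `1`. -/
lemma expect_strideMaj_eq_one (k : ℕ) (j : ℤ) :
    1 / 2 ≤ 𝔼 ω, (if strideMaj (pullInput π ω) k j = 1 then (1 : ℝ) else 0) := by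
  have h1 : 𝔼 ω, (if strideMaj (pullInput π ω) k j = 1 then (1 : ℝ) else 0) =
      𝔼 ω, (if strideMaj (pullInput π (-ω)) k j = 1 then (1 : ℝ) else 0) :=
    Fintype.expect_equiv (Equiv.neg _) _ _ fun ω => by simp
  have h2 : (1 : ℝ) ≤ 𝔼 ω : ι → ℤˣ, ((if strideMaj (pullInput π ω) k j = 1 then (1 : ℝ) else 0) +
      if strideMaj (pullInput π (-ω)) k j = 1 then (1 : ℝ) else 0) := by
    rw [← Fintype.expect_const (ι := ι → ℤˣ) (1 : ℝ)]
    refine Finset.expect_le_expect fun ω _ => ?_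
    by_cases h : strideMaj (pullInput π ω) k j = 1
    · rw [if_pos h]; split_ifs <;> norm_num
    · have h3 := strideMaj_mono (neg_pullInput_le π ω) k j
      rw [strideMaj_neg, (Int.units_eq_one_or _).resolve_left h, neg_neg] at h3
      have h4 : strideMaj (pullInput π (-ω)) k j = 1 := by
        revert h3; generalize strideMaj (pullInput π (-ω)) k j = u; revert u; decide
      rw [if_neg h, if_pos h4]; norm_num
  rw [Finset.expect_add_distrib, ← h1] at h2
  linarith

/-- The events are increasing, so they are positively correlated by the FKG inequality for the
uniform weight. -/
lemma expect_forall_strideMaj_eq_one (k : ℕ) (F : Finset ℤ) :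
    (1 / 2 : ℝ) ^ F.card ≤
      𝔼 ω, (if ∀ j ∈ F, strideMaj (pullInput π ω) k j = 1 then (1 : ℝ) else 0) := by
  induction F using Finset.induction_on with
  | empty => simp
  | insert a F ha ih =>
    have one_le : ∀ {u v : ℤˣ}, u ≤ v → u = 1 → v = 1 := by decide
    set f : (ι → ℤˣ) → ℝ := fun ω => if strideMaj (pullInput π ω) k a = 1 then 1 else 0 with hf
    set g : (ι → ℤˣ) → ℝ :=
      fun ω => if ∀ j ∈ F, strideMaj (pullInput π ω) k j = 1 then 1 else 0 with hg
    have hf0 : 0 ≤ f := fun ω => by simp only [hf]; split_ifs <;> simp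
    have hg0 : 0 ≤ g := fun ω => by simp only [hg]; split_ifs <;> simp
    have hfm : Monotone f := fun ω η h => by
      simp only [hf]
      split_ifs with h1 h2 <;> try norm_num
      exact h2 (one_le (strideMaj_mono (pullInput_mono π h) k a) h1)
    have hgm : Monotone g := fun ω η h => by
      simp only [hg]
      split_ifs with h1 h2 <;> try norm_num
      exact h2 fun j hj => one_le (strideMaj_mono (pullInput_mono π h) k j) (h1 j hj)
    have hk := fkg f g 1 zero_le_one hf0 hg0 hfm hgm fun _ _ => le_rfl
    simp only [Pi.one_apply, one_mul, Finset.sum_const, Finset.card_univ, nsmul_eq_mul,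
      mul_one] at hk
    have hcard : (0 : ℝ) < Fintype.card (ι → ℤˣ) := by exact_mod_cast Fintype.card_pos
    have hE : (𝔼 ω, f ω) * (𝔼 ω, g ω) ≤ 𝔼 ω, f ω * g ω := by
      simp only [Fintype.expect_eq_sum_div_card]
      rw [div_mul_div_comm, div_le_div_iff₀ (by positivity) hcard]
      calc _ ≤ (Fintype.card (ι → ℤˣ) * ∑ ω, f ω * g ω) * Fintype.card (ι → ℤˣ) :=
            mul_le_mul_of_nonneg_right hk hcard.le
        _ = _ := by ring
    have hi : ∀ ω, (if ∀ j ∈ insert a F, strideMaj (pullInput π ω) k j = 1 then (1 : ℝ) else 0) =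
        f ω * g ω := fun ω => by
      simp only [hf, hg, Finset.forall_mem_insert]
      by_cases h1 : strideMaj (pullInput π ω) k a = 1 <;> simp [h1]
    simp only [hi]
    rw [Finset.card_insert_of_notMem ha, pow_succ']
    exact (mul_le_mul (expect_strideMaj_eq_one π k a) ih (by positivity)
      ((by norm_num : (0 : ℝ) ≤ 1 / 2).trans (expect_strideMaj_eq_one π k a))).trans hE

end Lift

/-! ### Exponential decay of the revealment. -/

section Decay

/-- The layer coins as integers. -/
def coinValue {K : ℕ} (c : Fin K → Fin 4) (k : ℕ) : ℤ := if h : k < K then ((c ⟨k, h⟩ : ℕ) : ℤ) else 0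

variable {ι : Type} [Fintype ι] [DecidableEq ι]

open Classical in
/-- The probability that `x` is revealed from layer `k`. -/
noncomputable def revealProb (π : ℤ → Option ι) (K : ℕ) (x : ℤ) (k : ℕ) : ℝ :=
  𝔼 c : Fin K → Fin 4, 𝔼 ω, if RevealsAbove (coinValue c) (pullInput π ω) x k then 1 else 0

lemma revealProb_nonneg (π : ℤ → Option ι) (K : ℕ) (x : ℤ) (k : ℕ) : 0 ≤ revealProb π K x k :=
  Finset.expect_nonneg fun _ _ => Finset.expect_nonneg fun _ _ => by split_ifs <;> norm_num

lemma revealProb_le_one (π : ℤ → Option ι) (K : ℕ) (x : ℤ) (k : ℕ) : revealProb π K x k ≤ 1 :=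
  Finset.expect_le Finset.univ_nonempty fun _ _ => Finset.expect_le Finset.univ_nonempty
    fun _ _ => by split_ifs <;> norm_num

lemma revealProb_anti (π : ℤ → Option ι) (K : ℕ) (x : ℤ) {k l : ℕ} (h : k ≤ l) :
    revealProb π K x l ≤ revealProb π K x k :=
  Finset.expect_le_expect fun _ _ => Finset.expect_le_expect fun _ _ => by
    split_ifs with h1 h2 <;> try norm_num
    exact h2 (h1.mono h)

/-- The exponent 34 is 30 for the node values in `F` plus 4 for two coins with four values each. The
hypothesis `hπ` says that no input bit occurs twice in the window involved, so that disjoint cones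
read disjoint sets of bits. -/
lemma revealProb_add_three_le {π : ℤ → Option ι} {K : ℕ}
    (hπ : ∀ y z i, π y = some i → π z = some i → |y - z| < 2 ^ (K + 2) → y = z) (x : ℤ) {k : ℕ}
    (hk : k + 3 ≤ K) :
    revealProb π K x (k + 3) ≤ (1 - (1 / 2) ^ 34) * revealProb π K x k := by
  classical
  set a := x / 2 ^ k with ha
  set F : Finset ℤ := (Finset.Icc (a - 14) (a + 15)).filter fun j => j < a - 1 ∨ a + 2 < j with hF
  have hFcard : F.card ≤ 30 := (Finset.card_filter_le _ _).trans (by rw [Int.card_Icc]; omega)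
  set q : (Fin K → Fin 4) → (ι → ℤˣ) → ℝ := fun c ω =>
    if RevealsAbove (coinValue c) (pullInput π ω) x k then 1 else 0 with hq
  set A : (ι → ℤˣ) → ℝ := fun ω => if ∀ j ∈ F, strideMaj (pullInput π ω) k j = 1 then 1 else 0
    with hA
  obtain ⟨u, hu⟩ : ∃ u : Fin 4, ((u : ℕ) : ℤ) = (2 * (x / 2 ^ (k + 2)) + 1) % 4 :=
    ⟨⟨((2 * (x / 2 ^ (k + 2)) + 1) % 4).toNat, by omega⟩, by simp; omega⟩
  obtain ⟨v, hv⟩ : ∃ v : Fin 4, ((v : ℕ) : ℤ) = (x / 2 ^ (k + 1) - x / 2 ^ (k + 2)) % 4 :=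
    ⟨⟨((x / 2 ^ (k + 1) - x / 2 ^ (k + 2)) % 4).toNat, by omega⟩, by simp; omega⟩
  set i1 : Fin K := ⟨k + 1, by omega⟩
  set i2 : Fin K := ⟨k + 2, by omega⟩
  set B1 : (Fin K → Fin 4) → ℝ := fun c => if c i1 = u then 1 else 0 with hB1
  set B2 : (Fin K → Fin 4) → ℝ := fun c => if c i2 = v then 1 else 0 with hB2
  have hpoint : ∀ c ω, (if RevealsAbove (coinValue c) (pullInput π ω) x (k + 3) then (1 : ℝ) else 0)
      ≤ q c ω - B1 c * B2 c * (q c ω * A ω) := by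
    intro c ω
    by_cases h : RevealsAbove (coinValue c) (pullInput π ω) x (k + 3)
    · have h' : RevealsAbove (coinValue c) (pullInput π ω) x k := h.mono (by omega)
      have : B1 c * B2 c * (q c ω * A ω) = 0 := by
        by_contra hne
        simp only [hB1, hB2, hA, mul_eq_zero, not_or, ite_eq_right_iff, one_ne_zero,
          imp_false, not_not] at hne
        refine not_revealsAbove_add_three (fun j h1 h2 h3 => hne.2.2 j ?_) ?_ ?_ h
        · simp only [hF, Finset.mem_filter, Finset.mem_Icc]
          exact ⟨⟨h1, h2⟩, h3⟩
        · rw [← hu, ← hne.1.1, coinValue, dif_pos]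
        · rw [← hv, ← hne.1.2, coinValue, dif_pos]
      rw [this, if_pos h]
      simp [hq, h']
    · rw [if_neg h]
      have b1 : B1 c ≤ 1 ∧ 0 ≤ B1 c := by simp only [hB1]; split_ifs <;> norm_num
      have b2 : B2 c ≤ 1 ∧ 0 ≤ B2 c := by simp only [hB2]; split_ifs <;> norm_num
      have b3 : A ω ≤ 1 ∧ 0 ≤ A ω := by simp only [hA]; split_ifs <;> norm_num
      have b4 : 0 ≤ q c ω := by simp only [hq]; split_ifs <;> norm_num
      have b5 : B1 c * B2 c * A ω ≤ 1 :=
        mul_le_one₀ (mul_le_one₀ b1.1 b2.2 b2.1) b3.2 b3.1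
      nlinarith
  have hp : (0 : ℤ) < 2 ^ k := by positivity
  have hindep : ∀ c, 𝔼 ω, q c ω * A ω = (𝔼 ω, q c ω) * 𝔼 ω, A ω := by
    intro c
    -- The bits over the union of the cones of `a` and `a + 1`; the cones of the nodes in `F` avoid
    -- them.
    refine expect_mul_of_disjoint
      {i | ∃ z, 2 ^ k * (a - 1) < z ∧ z < 2 ^ k * (a + 2) ∧ π z = some i} ?_ ?_
    · intro ω η h
      have h1 : ∀ j, j = a ∨ j = a + 1 → (Reveals (coinValue c) (pullInput π ω) k j x ↔
          Reveals (coinValue c) (pullInput π η) k j x) := fun j hj =>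
        reveals_congr (fun _ _ => rfl) (fun y hy => pullInput_congr π fun i hi =>
          h i ⟨y, by rw [abs_lt] at hy; rcases hj with rfl | rfl <;> nlinarith,
            by rw [abs_lt] at hy; rcases hj with rfl | rfl <;> nlinarith, hi⟩) x
      simp only [hq, RevealsAbove, ← ha, h1 a (Or.inl rfl), h1 (a + 1) (Or.inr rfl)]
    · intro ω η h
      have h1 : ∀ j ∈ F, strideMaj (pullInput π ω) k j = strideMaj (pullInput π η) k j := by
        intro j hj
        simp only [hF, Finset.mem_filter, Finset.mem_Icc] at hj
        refine strideMaj_congr fun y hy => pullInput_congr π fun i hi => h i ?_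
        rintro ⟨z, hz1, hz2, hz⟩
        rw [abs_lt] at hy
        -- The cones of the nodes from `a - 14` to `a + 15` span a length of `31 * 2 ^ k`.
        have hpow : (2 : ℤ) ^ k * 32 ≤ 2 ^ (K + 2) := by
          rw [show (2 : ℤ) ^ k * 32 = 2 ^ (k + 5) by rw [pow_add]; norm_num]
          exact pow_le_pow_right₀ (by norm_num) (by omega)
        have l1 : 2 ^ k * (a - 14) ≤ 2 ^ k * j := mul_le_mul_of_nonneg_left hj.1.1 hp.le
        have l2 : 2 ^ k * j ≤ 2 ^ k * (a + 15) := mul_le_mul_of_nonneg_left hj.1.2 hp.le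
        have hyz := hπ y z i hi hz (by rw [abs_lt]; constructor <;> nlinarith)
        subst hyz
        rcases hj.2 with hj | hj
        · have : 2 ^ k * j ≤ 2 ^ k * (a - 2) := mul_le_mul_of_nonneg_left (by omega) hp.le
          nlinarith
        · have : 2 ^ k * (a + 3) ≤ 2 ^ k * j := mul_le_mul_of_nonneg_left (by omega) hp.le
          nlinarith
      have h2 : (∀ j ∈ F, strideMaj (pullInput π ω) k j = 1) ↔
          ∀ j ∈ F, strideMaj (pullInput π η) k j = 1 :=
        forall₂_congr fun j hj => by rw [h1 j hj]
      simp only [hA, h2]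
  -- Revealing from layer `k` uses only the coins of index below `k`.
  have hcoin : 𝔼 c, (𝔼 ω, q c ω) * (B1 c * B2 c) = (𝔼 c, 𝔼 ω, q c ω) * (1 / 16) := by
    rw [expect_mul_of_disjoint {i : Fin K | (i : ℕ) < k}]
    · congr 1
      rw [expect_mul_of_disjoint {i1}]
      · simp only [hB1, hB2, expect_ite_apply_eq]
        norm_num
      · intro c c' h
        simp only [hB1, h i1 rfl]
      · intro c c' h
        simp only [hB2, h i2 (by simp [i1, i2])]
    · intro c c' h
      have h1 : ∀ ω j, (Reveals (coinValue c) (pullInput π ω) k j x ↔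
          Reveals (coinValue c') (pullInput π ω) k j x) := fun ω j =>
        reveals_congr (fun i hi => by
          unfold coinValue
          split_ifs with hiK
          · rw [h ⟨i, hiK⟩ hi]
          · rfl) (fun _ _ => rfl) x
      refine Finset.expect_congr rfl fun ω _ => ?_
      simp only [hq]
      exact if_congr (by simp only [RevealsAbove, h1]) rfl rfl
    · intro c c' h
      simp only [hB1, hB2, h i1 (by simp [i1]), h i2 (by simp [i2])]
  have hAprob : (1 / 2 : ℝ) ^ 30 ≤ 𝔼 ω, A ω :=
    (pow_le_pow_of_le_one (by norm_num) (by norm_num) hFcard).trans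
      (expect_forall_strideMaj_eq_one π k F)
  have h0 : (0 : ℝ) ≤ 𝔼 c, 𝔼 ω, q c ω := revealProb_nonneg π K x k
  calc revealProb π K x (k + 3)
      ≤ 𝔼 c, 𝔼 ω, (q c ω - B1 c * B2 c * (q c ω * A ω)) :=
        Finset.expect_le_expect fun c _ => Finset.expect_le_expect fun ω _ => hpoint c ω
    _ = 𝔼 c, ((𝔼 ω, q c ω) - (𝔼 ω, q c ω) * (B1 c * B2 c) * 𝔼 ω, A ω) := by
        refine Finset.expect_congr rfl fun c _ => ?_
        rw [Finset.expect_sub_distrib, ← Finset.mul_expect, hindep]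
        ring
    _ = (𝔼 c, 𝔼 ω, q c ω) - (𝔼 c, 𝔼 ω, q c ω) * (1 / 16) * 𝔼 ω, A ω := by
        rw [Finset.expect_sub_distrib, ← Finset.expect_mul, hcoin]
    _ ≤ (𝔼 c, 𝔼 ω, q c ω) - (𝔼 c, 𝔼 ω, q c ω) * (1 / 16) * (1 / 2) ^ 30 := by
        have := mul_le_mul_of_nonneg_left hAprob (mul_nonneg h0 (by norm_num : (0 : ℝ) ≤ 1 / 16))
        linarith
    _ = (1 - (1 / 2) ^ 34) * revealProb π K x k := by
        rw [show revealProb π K x k = 𝔼 c, 𝔼 ω, q c ω from rfl]; ring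

lemma revealProb_le {π : ℤ → Option ι} {K : ℕ}
    (hπ : ∀ y z i, π y = some i → π z = some i → |y - z| < 2 ^ (K + 2) → y = z) (x : ℤ) :
    revealProb π K x K ≤ (1 - (1 / 2) ^ 34) ^ (K / 3) := by
  have h : ∀ t, 3 * t ≤ K → revealProb π K x (3 * t) ≤ (1 - (1 / 2) ^ 34) ^ t := by
    intro t
    induction t with
    | zero => intro _; simpa using revealProb_le_one π K x 0
    | succ t ih =>
      intro ht
      rw [pow_succ']
      exact (revealProb_add_three_le hπ x (by omega)).trans
        (mul_le_mul_of_nonneg_left (ih (by omega)) (by norm_num))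
  exact (revealProb_anti π K x (by omega)).trans (h (K / 3) (by omega))

/-- The noise covariance of a Boolean function that is determined by nodes of layer `K` of the
iterated 3-majority decays exponentially in `K`. -/
theorem abs_noiseCov_le_of_strideMaj {π : ℤ → Option ι} {K : ℕ} (s : Set ℤ)
    (hπ : ∀ y z i, π y = some i → π z = some i → |y - z| < 2 ^ (K + 2) → y = z)
    (hs : ∀ i, ∃ x, ∀ c (ω : ι → ℤˣ) y j, π y = some i → j ∈ s →
      Reveals c (pullInput π ω) K j y → ∃ j', Reveals c (pullInput π ω) K j' x)
    (f : (ι → ℤˣ) → ℤˣ)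
    (hf : ∀ ω η, (∀ j ∈ s, strideMaj (pullInput π ω) K j = strideMaj (pullInput π η) K j) →
      f ω = f η) {ε : ℝ} (h0 : 0 < ε) (h1 : ε ≤ 1 / 2) :
    |noiseCov f ε| ≤ (1 - (1 / 2) ^ 34) ^ (K / 3) * ((1 - 2 * ε) / (1 - (1 - 2 * ε)) ^ 2) := by
  classical
  set J : (Fin K → Fin 4) → (ι → ℤˣ) → Set ι := fun c ω =>
    {i | ∃ y, π y = some i ∧ ∃ j ∈ s, Reveals (coinValue c) (pullInput π ω) K j y} with hJ
  have key : ∀ c ω i, i ∉ J c ω → ∀ j ∈ s,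
      strideMaj (pullInput π (flipBit i ω)) K j = strideMaj (pullInput π ω) K j ∧
      ∀ x, Reveals (coinValue c) (pullInput π (flipBit i ω)) K j x ↔
        Reveals (coinValue c) (pullInput π ω) K j x := by
    intro c ω i hi j hj
    refine reveals_stable fun y hy hr => hi ⟨y, ?_, j, hj, hr⟩
    by_contra hne
    refine hy (pullInput_congr π fun l hl => (flipBit_apply_of_ne ?_ ω).symm)
    rintro rfl
    exact hne hl
  refine abs_noiseCov_le f (J := J) ?_ ?_ (pow_nonneg (by norm_num) _) ?_ h0 h1
  · intro c ω i hi
    ext l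
    simp only [hJ, Set.mem_ofPred_eq]
    refine exists_congr fun y => and_congr_right fun _ => exists_congr fun j =>
      and_congr_right fun hj => (key c ω i hi j hj).2 y
  · intro c ω i hi
    exact hf _ _ fun j hj => (key c ω i hi j hj).1
  · intro i
    -- Several integers can lie over `i`; `hs` moves them all to one `x`, so no union bound is
    -- needed.
    obtain ⟨x, hx⟩ := hs i
    refine le_trans ?_ (revealProb_le hπ x)
    refine Finset.expect_le_expect fun c _ => Finset.expect_le_expect fun ω _ => ?_
    split_ifs with h2 h3 <;> try norm_num
    obtain ⟨y, hy, j, hj, hr⟩ := h2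
    obtain ⟨j', hr'⟩ := hx _ ω y j hy hj hr
    exact h3 hr'.revealsAbove

end Decay

/-! ### The two graph families as instances of the integer model. -/

section Graphs

lemma LayeredGraph.value_succ_eq_majThree (G : LayeredGraph) (ω : G.Node 0 → ℤˣ) {k : ℕ}
    {v : G.Node (k + 1)} {a b c : G.Node k} (hab : a ≠ b) (hac : a ≠ c) (hbc : b ≠ c)
    (h : ∀ u : G.Node k, G.edge k v u ↔ u = a ∨ u = b ∨ u = c) :
    G.value ω (k + 1) v = majThree (G.value ω k a) (G.value ω k b) (G.value ω k c) := by
  classical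
  have hc : G.children k v = {a, b, c} := by
    ext u
    simp [LayeredGraph.children, h]
  rw [LayeredGraph.value, hc, Finset.sum_insert (by simp [hab, hac]),
    Finset.sum_insert (by simp [hbc]), Finset.sum_singleton, majThree, add_assoc]

lemma strideMaj_add_congr {w w' : ℤ → ℤˣ} {k : ℕ} (h : ∀ j, strideMaj w k j = strideMaj w' k j)
    (l : ℕ) (j : ℤ) : strideMaj w (k + l) j = strideMaj w' (k + l) j := by
  induction l generalizing j with
  | zero => exact h j
  | succ l ih =>
    rw [← add_assoc]
    simp only [strideMaj, ih]

/-- The input sites `1, …, N` as integers. -/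
def lineSite (N : ℕ) (y : ℤ) : Option (Finset.Icc 1 N) :=
  if h : 1 ≤ y ∧ y ≤ N then some ⟨y.toNat, by rw [Finset.mem_Icc]; omega⟩ else none

lemma lineSite_eq_some {N : ℕ} {y : ℤ} {i : Finset.Icc 1 N} :
    lineSite N y = some i ↔ y = ((i : ℕ) : ℤ) := by
  have hi := Finset.mem_Icc.1 i.2
  unfold lineSite
  split_ifs with h
  · rw [Option.some_inj, Subtype.ext_iff]
    simp only
    omega
  · simp only [false_iff]
    omega

lemma strideTwoGraph_value {n k : ℕ} (hk : k ≤ n) (ω : (strideTwoGraph n).Node 0 → ℤˣ)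
    (v : (strideTwoGraph n).Node k) :
    (strideTwoGraph n).value ω k v =
      strideMaj (pullInput (lineSite ((strideTwoGraph n).width 0)) ω) k ((v : ℕ) : ℤ) := by
  induction k with
  | zero =>
    rw [strideMaj, pullInput, lineSite_eq_some.2 rfl]
    rfl
  | succ k ih =>
    have hv : 1 ≤ (v : ℕ) ∧ (v : ℕ) ≤ 2 ^ (n - (k + 1) + 1) - 1 := Finset.mem_Icc.1 v.2
    have hw : (strideTwoGraph n).width k = 2 * 2 ^ (n - (k + 1) + 1) - 1 := by
      rw [← pow_succ', show n - (k + 1) + 1 + 1 = n - k + 1 by omega]; rfl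
    let a : (strideTwoGraph n).Node k := ⟨2 * v - 1, by rw [Finset.mem_Icc, hw]; omega⟩
    let b : (strideTwoGraph n).Node k := ⟨2 * v, by rw [Finset.mem_Icc, hw]; omega⟩
    let c : (strideTwoGraph n).Node k := ⟨2 * v + 1, by rw [Finset.mem_Icc, hw]; omega⟩
    have hab : a ≠ b := by simp only [a, b, ne_eq, Subtype.mk.injEq]; omega
    have hac : a ≠ c := by simp only [a, c, ne_eq, Subtype.mk.injEq]; omega
    have hbc : b ≠ c := by simp only [b, c, ne_eq, Subtype.mk.injEq]; omega
    rw [LayeredGraph.value_succ_eq_majThree _ ω hab hac hbc, ih (by omega), ih (by omega),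
      ih (by omega), strideMaj]
    · congr 2
      simp only [a]
      omega
    · intro u
      change |((u : ℕ) : ℤ) - 2 * ((v : ℕ) : ℤ)| ≤ 1 ↔ _
      rw [Subtype.ext_iff, Subtype.ext_iff, Subtype.ext_iff, abs_le]
      simp only [a, b, c]
      omega

theorem abs_noiseCov_strideTwoGraph_le (n : ℕ) {ε : ℝ} (h0 : 0 < ε) (h1 : ε ≤ 1 / 2) :
    |noiseCov (strideTwoGraph n).output ε| ≤
      (1 - (1 / 2) ^ 34) ^ (n / 3) * ((1 - 2 * ε) / (1 - (1 - 2 * ε)) ^ 2) := by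
  refine abs_noiseCov_le_of_strideMaj (π := lineSite ((strideTwoGraph n).width 0)) {1} ?_ ?_ _ ?_ h0 h1
  · intro y z i hy hz _
    rw [lineSite_eq_some.1 hy, lineSite_eq_some.1 hz]
  · intro i
    refine ⟨((i : ℕ) : ℤ), fun c ω y j hy _ hr => ⟨j, ?_⟩⟩
    rwa [← lineSite_eq_some.1 hy]
  · intro ω η h
    have e := h 1 rfl
    rw [LayeredGraph.output, LayeredGraph.output]
    have e1 := strideTwoGraph_value le_rfl ω (strideTwoGraph n).root
    have e2 := strideTwoGraph_value le_rfl η (strideTwoGraph n).root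
    exact e1.trans (e.trans e2.symm)

/-- The site of the cycle `1, …, N` congruent to an integer. -/
def cycleSite (N : ℕ) (hN : 0 < N) (y : ℤ) : Finset.Icc 1 N :=
  ⟨((y - 1) % N).toNat + 1, by
    have h1 := Int.emod_nonneg (y - 1) (show (N : ℤ) ≠ 0 by omega)
    have h2 := Int.emod_lt_of_pos (y - 1) (show 0 < (N : ℤ) by omega)
    rw [Finset.mem_Icc]; omega⟩

lemma cycleSite_modEq {N : ℕ} (hN : 0 < N) (y : ℤ) : ((cycleSite N hN y : ℕ) : ℤ) ≡ y [ZMOD N] := by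
  have h1 := Int.emod_nonneg (y - 1) (show (N : ℤ) ≠ 0 by omega)
  have h2 : ((cycleSite N hN y : ℕ) : ℤ) = (y - 1) % N + 1 := by simp only [cycleSite]; omega
  rw [h2]
  simpa using (Int.mod_modEq (y - 1) N).add_right 1

lemma eq_cycleSite_iff {N : ℕ} (hN : 0 < N) {y : ℤ} {i : Finset.Icc 1 N} :
    i = cycleSite N hN y ↔ ((i : ℕ) : ℤ) ≡ y [ZMOD N] := by
  constructor
  · rintro rfl
    exact cycleSite_modEq hN y
  · intro h
    have hi := Finset.mem_Icc.1 i.2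
    have hc := Finset.mem_Icc.1 (cycleSite N hN y).2
    obtain ⟨t, ht⟩ := (h.trans (cycleSite_modEq hN y).symm).dvd
    have h1 : t < 1 := by
      by_contra! h
      nlinarith
    have h2 : -1 < t := by
      by_contra! h
      nlinarith
    have h3 : t = 0 := by omega
    subst h3
    rw [Subtype.ext_iff]
    omega

lemma cycleSite_eq_cycleSite_iff {N : ℕ} (hN : 0 < N) {y z : ℤ} :
    cycleSite N hN y = cycleSite N hN z ↔ y ≡ z [ZMOD N] := by
  rw [eq_cycleSite_iff]
  exact ⟨(cycleSite_modEq hN y).symm.trans, (cycleSite_modEq hN y).trans⟩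

lemma cycleSite_ne {N : ℕ} (hN : 3 ≤ N) (y : ℤ) {d : ℤ} (h1 : 1 ≤ d) (h2 : d ≤ 2) :
    cycleSite N (by omega) y ≠ cycleSite N (by omega) (y + d) := by
  rw [ne_eq, cycleSite_eq_cycleSite_iff]
  intro h
  have := Int.le_of_dvd (by omega) h.dvd
  omega

variable {m T : ℕ}

lemma strideTwoCycle_width_of_le {k : ℕ} (hk : k ≤ T) :
    (strideTwoCycle m T).width k = m * 2 ^ (T - k) := by
  simp [strideTwoCycle, hk]

lemma three_le_strideTwoCycle_width (hm : 3 ≤ m) {k : ℕ} (hk : k ≤ T) :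
    3 ≤ (strideTwoCycle m T).width k := by
  rw [strideTwoCycle_width_of_le hk]
  exact hm.trans (Nat.le_mul_of_pos_right m (by positivity))

lemma strideTwoCycle_edge_iff {k : ℕ} (hk : k < T) (hN : 0 < (strideTwoCycle m T).width k) (v : ℕ)
    (u : (strideTwoCycle m T).Node k) :
    (strideTwoCycle m T).edge k v u ↔
      u = cycleSite _ hN (2 * v - 1) ∨ u = cycleSite _ hN (2 * v - 1 + 1) ∨
        u = cycleSite _ hN (2 * v - 1 + 2) := by
  simp only [eq_cycleSite_iff]
  generalize (u : ℕ) = j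
  rw [strideTwoCycle_width_of_le hk.le]
  simp only [strideTwoCycle, if_pos hk]
  constructor
  · rintro ⟨e, he, h⟩
    rw [abs_le] at he
    obtain rfl | rfl | rfl : e = -1 ∨ e = 0 ∨ e = 1 := by omega
    · left; exact h
    · right; left; simpa using h
    · right; right; convert h using 1; ring
  · rintro (h | h | h)
    · exact ⟨-1, by norm_num, by convert h using 1; ring⟩
    · exact ⟨0, by norm_num, by simpa using h⟩
    · exact ⟨1, by norm_num, by convert h using 1; ring⟩

/-- The site of the input cycle over an integer. -/
def cycleInput (hN : 0 < (strideTwoCycle m T).width 0) (y : ℤ) :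
    Option ((strideTwoCycle m T).Node 0) := some (cycleSite _ hN y)

lemma pullInput_cycleInput_periodic (hN : 0 < (strideTwoCycle m T).width 0)
    (ω : (strideTwoCycle m T).Node 0 → ℤˣ) {k : ℕ} (hk : k ≤ T) (t y : ℤ) :
    pullInput (cycleInput hN) ω (y + 2 ^ k * ((m * 2 ^ (T - k) : ℕ) * t)) =
      pullInput (cycleInput hN) ω y := by
  have h : cycleSite _ hN (y + 2 ^ k * ((m * 2 ^ (T - k) : ℕ) * t)) = cycleSite _ hN y := by
    rw [cycleSite_eq_cycleSite_iff, strideTwoCycle_width_of_le (Nat.zero_le T)]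
    have e : (2 : ℤ) ^ k * ((m * 2 ^ (T - k) : ℕ) * t) = ((m * 2 ^ (T - 0) : ℕ) : ℤ) * t := by
      have : (2 : ℤ) ^ k * 2 ^ (T - k) = 2 ^ T := by rw [← pow_add, Nat.add_sub_cancel' hk]
      push_cast
      rw [Nat.sub_zero, ← this]; ring
    rw [e]
    exact (Int.modEq_iff_dvd.2 ⟨t, by ring⟩ : y ≡ _ [ZMOD _]).symm
  simp only [pullInput, cycleInput, h]

lemma strideTwoCycle_value (hm : 3 ≤ m) (hN : 0 < (strideTwoCycle m T).width 0) {k : ℕ}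
    (hk : k ≤ T) (ω : (strideTwoCycle m T).Node 0 → ℤˣ) (v : (strideTwoCycle m T).Node k) :
    (strideTwoCycle m T).value ω k v =
      strideMaj (pullInput (cycleInput hN) ω) k ((v : ℕ) : ℤ) := by
  induction k with
  | zero =>
    rw [strideMaj, pullInput, cycleInput, ← (eq_cycleSite_iff hN).2 (Int.ModEq.refl _)]
    rfl
  | succ k ih =>
    have hNk := three_le_strideTwoCycle_width (T := T) hm (k := k) (by omega)
    have hper : ∀ u : ℤ, strideMaj (pullInput (cycleInput hN) ω) k
        ((cycleSite ((strideTwoCycle m T).width k) (by omega) u : ℕ) : ℤ) =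
        strideMaj (pullInput (cycleInput hN) ω) k u := by
      intro u
      obtain ⟨t, ht⟩ := (cycleSite_modEq (N := (strideTwoCycle m T).width k) (by omega) u).dvd
      generalize ((cycleSite ((strideTwoCycle m T).width k) (by omega) u : ℕ) : ℤ) = z at ht ⊢
      rw [strideTwoCycle_width_of_le (by omega : k ≤ T)] at ht
      rw [← strideMaj_add_period (pullInput_cycleInput_periodic hN ω (by omega : k ≤ T) t) z, ← ht]
      congr 1
      ring
    rw [LayeredGraph.value_succ_eq_majThree _ ω (cycleSite_ne hNk (2 * ((v : ℕ) : ℤ) - 1) le_rfl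
      one_le_two) (cycleSite_ne hNk _ one_le_two le_rfl) ?_
      (strideTwoCycle_edge_iff (by omega) (by omega) v), ih (by omega), ih (by omega),
      ih (by omega), hper, hper, hper, strideMaj]
    · congr 2 <;> ring
    · have := cycleSite_ne hNk (2 * ((v : ℕ) : ℤ) - 1 + 1) le_rfl one_le_two
      rwa [add_assoc _ (1 : ℤ) 1] at this

/-- The algorithm evaluates all nodes of layer `K = T - 2`, which determine the output. With this
`K` the window `2 ^ (K + 2) = 2 ^ T` is shorter than the input cycle, and the layer period `4 * m`
is even, as `reveals_add_period` requires. -/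
theorem abs_noiseCov_strideTwoCycle_le (hm : 3 ≤ m) (hT : 2 ≤ T) {ε : ℝ} (h0 : 0 < ε)
    (h1 : ε ≤ 1 / 2) :
    |noiseCov (strideTwoCycle m T).output ε| ≤
      (1 - (1 / 2) ^ 34) ^ ((T - 2) / 3) * ((1 - 2 * ε) / (1 - (1 - 2 * ε)) ^ 2) := by
  have hN : 0 < (strideTwoCycle m T).width 0 :=
    lt_of_lt_of_le (by norm_num) (three_le_strideTwoCycle_width hm (Nat.zero_le T))
  have hmod : ∀ y i, cycleInput hN y = some i → ((i : ℕ) : ℤ) ≡ y [ZMOD (m * 2 ^ T : ℕ)] := by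
    intro y i h
    have := (eq_cycleSite_iff hN).1 (Option.some_inj.1 h).symm
    generalize ((i : ℕ) : ℤ) = z at this ⊢
    rwa [strideTwoCycle_width_of_le (Nat.zero_le T)] at this
  refine abs_noiseCov_le_of_strideMaj (π := cycleInput hN) Set.univ ?_ ?_ _ ?_ h0 h1
  · intro y z i hy hz hyz
    obtain ⟨t, ht⟩ := ((hmod z i hz).symm.trans (hmod y i hy)).dvd
    rw [Nat.sub_add_cancel hT] at hyz
    rw [ht] at hyz
    by_contra hne
    have ht0 : t ≠ 0 := by
      rintro rfl
      exact hne (by linarith)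
    have h2 : (2 : ℤ) ^ T ≤ |((m * 2 ^ T : ℕ) : ℤ) * t| := by
      rw [abs_mul, Nat.abs_cast]
      have h3 : (1 : ℤ) ≤ |t| := Int.one_le_abs ht0
      have h4 : (2 : ℤ) ^ T ≤ ((m * 2 ^ T : ℕ) : ℤ) := by
        exact_mod_cast Nat.le_mul_of_pos_left _ (by omega)
      have h5 : (0 : ℤ) ≤ 2 ^ T := by positivity
      nlinarith
    omega
  · intro i
    refine ⟨((i : ℕ) : ℤ), fun c ω y j hy _ hr => ?_⟩
    obtain ⟨t, ht⟩ := (hmod y i hy).symm.dvd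
    refine ⟨j + (m * 2 ^ (T - (T - 2)) : ℕ) * t, ?_⟩
    have hp := reveals_add_period (c := c) (p := (m * 2 ^ (T - (T - 2)) : ℕ) * t) ?_
      (pullInput_cycleInput_periodic hN ω (Nat.sub_le T 2) t) j y
    · convert hp.2 hr using 1
      have e : (2 : ℤ) ^ (T - 2) * ((m * 2 ^ (T - (T - 2)) : ℕ) * t) = ((m * 2 ^ T : ℕ) : ℤ) * t := by
        have : (2 : ℤ) ^ (T - 2) * 2 ^ (T - (T - 2)) = 2 ^ T := by
          rw [← pow_add, Nat.add_sub_cancel' (Nat.sub_le T 2)]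
        push_cast
        rw [← this]; ring
      rw [e, ← ht]; ring
    · rw [show T - (T - 2) = 2 by omega]
      push_cast
      exact ⟨m * 2 * t, by ring⟩
  · intro ω η h
    have hv : ∀ u, (strideTwoCycle m T).value ω T u = (strideTwoCycle m T).value η T u := by
      intro u
      rw [strideTwoCycle_value hm hN le_rfl, strideTwoCycle_value hm hN le_rfl]
      have := strideMaj_add_congr (fun j => h j trivial) 2 ((u : ℕ) : ℤ)
      rwa [Nat.sub_add_cancel hT] at this
    change (strideTwoCycle m T).value ω (T + 1) _ = (strideTwoCycle m T).value η (T + 1) _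
    simp only [LayeredGraph.value, hv]

lemma tendsto_decay_mul {K : ℕ → ℕ} (hK : Tendsto K atTop atTop) (C : ℝ) :
    Tendsto (fun n => (1 - (1 / 2 : ℝ) ^ 34) ^ (K n / 3) * C) atTop (𝓝 0) := by
  have h1 : Tendsto (fun n => K n / 3) atTop atTop :=
    (Nat.tendsto_div_const_atTop (by norm_num)).comp hK
  simpa using ((tendsto_pow_atTop_nhds_zero_of_lt_one (by norm_num) (by norm_num)).comp
    h1).mul_const C

end Graphs

theorem mainTheorem9 :
    NoiseSensitive (fun n => (strideTwoGraph n).output) ∧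
    ∀ m T : ℕ → ℕ, (∀ n, 3 ≤ m n) → (∀ n, Odd (m n)) → Tendsto T atTop atTop →
      NoiseSensitive (fun n => (strideTwoCycle (m n) (T n)).output) := by
  refine ⟨fun ε h0 h1 => ?_, fun m T hm _ hT ε h0 h1 => ?_⟩
  · exact squeeze_zero_norm (fun n => abs_noiseCov_strideTwoGraph_le n h0 h1)
      (tendsto_decay_mul tendsto_id _)
  · have hT' : Tendsto (fun n => T n - 2) atTop atTop := (tendsto_sub_atTop_nat 2).comp hT
    refine squeeze_zero_norm' ?_ (tendsto_decay_mul hT' ((1 - 2 * ε) / (1 - (1 - 2 * ε)) ^ 2))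
    filter_upwards [hT.eventually_ge_atTop 2] with n hn
    exact abs_noiseCov_strideTwoCycle_le (hm n) hn h0 h1
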